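/- **Theorem (combination theorem for quadrilaterals of groups).** For all real numbers $R_0>0$, $r>0$, $\alpha>0$ there is a constant $C=C(R_0,r,\alpha)$ such that the following holds for all $R\ge C$ and $R_1\ge C$. *The vertex group.* Let $L\subset\mathbb H^5$ be a 3-dimensional hyperbolic (totally geodesic) subspace, and let $G_1\subset \mathrm{Isom}(\mathbb H^5)$ be a discrete subgroup that preserves $L$ and acts faithfully on it (for instance, a discrete subgroup of $\mathrm{Isom}(L)$, extended by the identity in the directions normal to $L$). Let $G_{\epsilon_1},G_{\epsilon_2}$ be two infinite maximal cyclic subgroups of $G_1$ that are not conjugate in $G_1$, with invariant geodesics $\gamma_1,\gamma_2\subset L$, and suppose that $G_{\epsilon_i}$ is the full stabilizer of $\gamma_i$ in $G_1$ (this is automatic if $G_1$ is torsion-free). Write $d(A,B)=\inf_{a\in A,\,b\in B}d(a,b)$ for nonempty sets $A,B\subset\mathbb H^5$, and let $\mathrm{proj}_\gamma$ be the nearest-point projection to $\gamma$. Assume: 1. $d(\gamma_1,\gamma_2)=R_0$. 2. $R>R_0$, and any two distinct geodesics $\beta,\beta'$ in the $G_1$-orbits of $\gamma_1,\gamma_2$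 satisfy $d(\beta,\beta')\ge R$, unless some $g\in G_1$ carries $\beta\cup\beta'$ to $\gamma_1\cup\gamma_2$. 3. For $i=1,2$ and any two distinct geodesics $\beta,\beta'$ in the $G_1$-orbits of $\gamma_1,\gamma_2$ with $d(\beta,\gamma_i)=d(\beta',\gamma_i)=R_0$, one has $d(\mathrm{proj}_{\gamma_i}(\beta),\mathrm{proj}_{\gamma_i}(\beta'))\ge R_1$. *The involutions.* Let $S_1,S_2\subset\mathbb H^5$ be 3-dimensional hyperbolic subspaces with $S_i\cap L=\gamma_i$, such that $S_1$ and $S_2$ are orthogonal along $S_1\cap S_2$ and $S_1\cap S_2$ is a geodesic with $d(S_1\cap S_2,L)\ge r/2$. Let $\sigma_1,\sigma_2$ be commuting isometric involutions of $\mathbb H^5$ with fixed-point sets $S_1,S_2$, and assume that $\sigma_i$ commutes with every element of $G_{\epsilon_i}$. Assume finally that, for $i=1,2$, $L$ and $\sigma_i(L)$ meet along $\gamma_i$ at angles at least $\alpha$: each unit vector tangent to $L$ and normal to $\gamma_i$ makes an angle at least $\alpha$ with each unit vector at the same point that is tangent to $\sigma_i(L)$ and normal to $\gamma_i$. *The quadrilateral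 of groups.* Let $Q$ be the quadrilateral of groups with trivial face group whose vertex groups $G_1,G_2,G_3,G_4$ (in cyclic order) are copies of $G_1$; the edges $[1,2]$ and $[3,4]$ carry copies of $G_{\epsilon_2}$, the edges $[2,3]$ and $[4,1]$ carry copies of $G_{\epsilon_1}$, and each edge group embeds in its two vertex groups by the inclusion. Let $G=\pi_1(Q)$ be the direct limit of this diagram of groups, and let $\phi:G\to\mathrm{Isom}(\mathbb H^5)$ be the homomorphism whose restrictions to the vertex groups are $$\phi|_{G_1}=\phi_1,\quad \phi|_{G_2}=\mathrm{Ad}_{\sigma_2}\circ\phi_1,\quad \phi|_{G_3}=\mathrm{Ad}_{\sigma_1\sigma_2}\circ\phi_1,\quad \phi|_{G_4}=\mathrm{Ad}_{\sigma_1}\circ\phi_1,$$ where $\phi_1:G_1\hookrightarrow\mathrm{Isom}(\mathbb H^5)$ is the inclusion. Then $\phi$ is injective and its image is a discrete subgroup of $\mathrm{Isom}(\mathbb H^5)$. -/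

import Mathlib

open scoped Pointwise

/-! Hyperbolic space, in the hyperboloid model. -/

/-- The Lorentz form `-x₀y₀ + x₁y₁ + ⋯ + xₙyₙ` on `ℝⁿ⁺¹`. -/
def lorentz {n : ℕ} (x y : Fin (n + 1) → ℝ) : ℝ :=
  -(x 0 * y 0) + ∑ i : Fin n, x i.succ * y i.succ

/-- Hyperbolic `n`-space: the upper sheet of the hyperboloid `⟨x, x⟩ = -1`. -/
def Hyp (n : ℕ) : Type :=
  {x : Fin (n + 1) → ℝ // lorentz x x = -1 ∧ 0 < x 0}

/-- The vector of `ℝⁿ⁺¹` underlying a point of hyperbolic space. -/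
def Hyp.vec {n : ℕ} (x : Hyp n) : Fin (n + 1) → ℝ := x.1

/-- The hyperbolic distance: `cosh d(x, y) = -⟨x, y⟩`. -/
noncomputable def hypDist {n : ℕ} (x y : Hyp n) : ℝ :=
  Real.arcosh (-lorentz x.vec y.vec)

/-- The distance between two (nonempty) subsets: the infimum of the distances of their points. -/
noncomputable def setDist {n : ℕ} (A B : Set (Hyp n)) : ℝ :=
  sInf {d | ∃ x ∈ A, ∃ y ∈ B, d = hypDist x y}

/-- The image of `B` under the nearest-point projection to `A`. -/
def nearestProj {n : ℕ} (A B : Set (Hyp n)) : Set (Hyp n) :=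
  {y | y ∈ A ∧ ∃ x ∈ B, ∀ z ∈ A, hypDist x y ≤ hypDist x z}

/-- The isometry group of hyperbolic `n`-space, as the group of all linear automorphisms of
`ℝⁿ⁺¹` that preserve the Lorentz form and the upper sheet of the hyperboloid.
Its topology is the one induced from `GL (n + 1, ℝ)`. -/
def IsomHyp (n : ℕ) : Subgroup (GL (Fin (n + 1)) ℝ) where
  carrier := {g | (∀ x y, lorentz (g.1.mulVec x) (g.1.mulVec y) = lorentz x y) ∧
    ∀ x, lorentz x x = -1 → (0 < (g.1.mulVec x) 0 ↔ 0 < x 0)}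
  one_mem' := by
    constructor <;> simp
  mul_mem' := by
    rintro a b ⟨ha, ha'⟩ ⟨hb, hb'⟩
    refine ⟨fun x y => ?_, fun x hx => ?_⟩
    · simp only [Units.val_mul, ← Matrix.mulVec_mulVec, ha, hb]
    · simp only [Units.val_mul, ← Matrix.mulVec_mulVec]
      rw [ha' _ (by rw [hb, hx]), hb' _ hx]
  inv_mem' := by
    rintro a ⟨ha, ha'⟩
    have key : ∀ x, a.1.mulVec ((a⁻¹).1.mulVec x) = x := fun x => by
      rw [Matrix.mulVec_mulVec, ← Units.val_mul, mul_inv_cancel, Units.val_one,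
        Matrix.one_mulVec]
    refine ⟨fun x y => ?_, fun x hx => ?_⟩
    · rw [← ha, key, key]
    · rw [← ha' _ (by rw [← ha, key, hx]), key]

/-- Isometries act on hyperbolic space. -/
instance IsomHyp.action (n : ℕ) : MulAction (IsomHyp n) (Hyp n) where
  smul g x := ⟨g.1.1.mulVec x.1, by rw [g.2.1]; exact x.2.1, (g.2.2 _ x.2.1).2 x.2.2⟩
  one_smul x := Subtype.ext (Matrix.one_mulVec x.1)
  mul_smul g h x := Subtype.ext (Matrix.mulVec_mulVec x.1 g.1.1 h.1.1).symm

/-- The linear span in `ℝⁿ⁺¹` of a subset of hyperbolic space. -/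
def linSpan {n : ℕ} (A : Set (Hyp n)) : Submodule ℝ (Fin (n + 1) → ℝ) :=
  Submodule.span ℝ (Hyp.vec '' A)

/-- `A` is a `k`-dimensional hyperbolic (totally geodesic) subspace: the nonempty intersection
of hyperbolic space with a `(k + 1)`-dimensional linear subspace. For `k = 1` these are the
(complete) geodesics. -/
def IsHypSubspace {n : ℕ} (k : ℕ) (A : Set (Hyp n)) : Prop :=
  A.Nonempty ∧ ∃ V : Submodule ℝ (Fin (n + 1) → ℝ),
    Module.finrank ℝ V = k + 1 ∧ A = {x | x.vec ∈ V}

/-- The hyperbolic subspaces `A` and `B`, which both contain the hyperbolic subspace `C`, meet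
along `C` at angles at least `α`: any unit vector tangent to `A` and normal to `C` makes an angle
at least `α` with any unit vector tangent to `B` and normal to `C`. (The space of vectors that are
tangent to `A` at a point of `C` and normal to `C` is the Lorentz-orthogonal complement of
`linSpan C` in `linSpan A`, whatever the point.) -/
def MeetAtAngle {n : ℕ} (C A B : Set (Hyp n)) (α : ℝ) : Prop :=
  ∀ u ∈ linSpan A, ∀ v ∈ linSpan B,
    (∀ x ∈ C, lorentz u x.vec = 0) → (∀ x ∈ C, lorentz v x.vec = 0) →
    lorentz u u = 1 → lorentz v v = 1 → α ≤ Real.arccos (lorentz u v)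

/-! Quadrilaterals of groups. -/

/-- A quadrilateral of groups with trivial face group. The vertices are `0, 1, 2, 3` in cyclic
order; the edge `i` joins the vertices `i` and `i + 1`. -/
structure QuadrilateralOfGroups where
  vert : Fin 4 → Type
  edge : Fin 4 → Type
  [vertGroup : ∀ i, Group (vert i)]
  [edgeGroup : ∀ i, Group (edge i)]
  toFst : ∀ i, edge i →* vert i
  toSnd : ∀ i, edge i →* vert (i + 1)
  toFst_injective : ∀ i, Function.Injective (toFst i)
  toSnd_injective : ∀ i, Function.Injective (toSnd i)

attribute [instance] QuadrilateralOfGroups.vertGroup QuadrilateralOfGroups.edgeGroup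

namespace QuadrilateralOfGroups

/-- The relations that identify the two images of each edge group. -/
def relations (Q : QuadrilateralOfGroups) : Set (Monoid.CoprodI Q.vert) :=
  {x | ∃ (i : Fin 4) (h : Q.edge i),
    x = Monoid.CoprodI.of (Q.toFst i h) * (Monoid.CoprodI.of (Q.toSnd i h))⁻¹}

/-- The fundamental group: the direct limit (colimit) of the diagram of vertex and edge groups,
that is, the free product of the vertex groups in which the two images of each edge group are
identified. -/
def FundamentalGroup (Q : QuadrilateralOfGroups) : Type :=
  Monoid.CoprodI Q.vert ⧸ Subgroup.normalClosure Q.relations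

instance (Q : QuadrilateralOfGroups) : Group Q.FundamentalGroup :=
  inferInstanceAs (Group (Monoid.CoprodI Q.vert ⧸ Subgroup.normalClosure Q.relations))

/-- The canonical homomorphism of a vertex group to the fundamental group. -/
def of (Q : QuadrilateralOfGroups) (i : Fin 4) : Q.vert i →* Q.FundamentalGroup :=
  (QuotientGroup.mk' (Subgroup.normalClosure Q.relations)).comp Monoid.CoprodI.of

/-- The homomorphism induced by a compatible family of homomorphisms of the vertex groups. -/
def lift (Q : QuadrilateralOfGroups) {H : Type*} [Group H] (f : ∀ i, Q.vert i →* H)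
    (hf : ∀ i (h : Q.edge i), f i (Q.toFst i h) = f (i + 1) (Q.toSnd i h)) :
    Q.FundamentalGroup →* H :=
  QuotientGroup.lift (Subgroup.normalClosure Q.relations) (Monoid.CoprodI.lift f) (by
    have hle : Subgroup.normalClosure Q.relations ≤ (Monoid.CoprodI.lift f).ker := by
      apply Subgroup.normalClosure_le_normal
      rintro x ⟨i, h, rfl⟩
      simp [MonoidHom.mem_ker, hf]
    exact fun x hx => hle hx)

theorem lift_of (Q : QuadrilateralOfGroups) {H : Type*} [Group H] (f : ∀ i, Q.vert i →* H)
    (hf : ∀ i (h : Q.edge i), f i (Q.toFst i h) = f (i + 1) (Q.toSnd i h))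
    (i : Fin 4) (g : Q.vert i) : Q.lift f hf (Q.of i g) = f i g :=
  Monoid.CoprodI.lift_of f g

end QuadrilateralOfGroups

/-- The quadrilateral of groups whose vertex groups are four copies of `Γ` and whose edge groups
are, in cyclic order, copies of `A 1`, `A 0`, `A 1`, `A 0`, all embedded by the inclusion. -/
def squareOfCopies {Γ : Type} [Group Γ] (A : Fin 2 → Subgroup Γ) : QuadrilateralOfGroups where
  vert _ := Γ
  edge i := A (![1, 0, 1, 0] i)
  toFst i := (A (![1, 0, 1, 0] i)).subtype
  toSnd i := (A (![1, 0, 1, 0] i)).subtype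
  toFst_injective i := (A (![1, 0, 1, 0] i)).subtype_injective
  toSnd_injective i := (A (![1, 0, 1, 0] i)).subtype_injective

/-! The geometric data. -/

/-- The data from which the representation is built. The indices `0, 1 : Fin 2` stand for
`1, 2` in the usual notation `γ₁, γ₂`, `S₁, S₂`, `σ₁, σ₂`. -/
structure QuadrilateralData where
  /-- A copy of hyperbolic 3-space. -/
  L : Set (Hyp 5)
  isHypSubspace_L : IsHypSubspace 3 L
  /-- A discrete group of isometries that acts faithfully on `L`. -/
  G : Subgroup (IsomHyp 5)
  discrete : DiscreteTopology G
  smul_L : ∀ g ∈ G, g • L = L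
  faithful_on_L : ∀ g ∈ G, (∀ x ∈ L, g • x = x) → g = 1
  /-- The two edge groups, infinite maximal cyclic subgroups of `G`, not conjugate in `G`. -/
  A : Fin 2 → Subgroup G
  isCyclic_A : ∀ i, IsCyclic (A i)
  infinite_A : ∀ i, Infinite (A i)
  maximal_A : ∀ i, ∀ C : Subgroup G, IsCyclic C → A i ≤ C → C = A i
  not_conj_A : ∀ g : G, (A 0).map (MulAut.conj g).toMonoidHom ≠ A 1
  /-- Their invariant geodesics in `L`. -/
  γ : Fin 2 → Set (Hyp 5)
  isHypSubspace_γ : ∀ i, IsHypSubspace 1 (γ i)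
  γ_subset_L : ∀ i, γ i ⊆ L
  smul_γ : ∀ i, ∀ a ∈ A i, (a : IsomHyp 5) • γ i = γ i
  /-- The edge group is the full stabilizer of its geodesic (automatic if `G` is torsion-free). -/
  mem_A_of_smul_γ : ∀ i, ∀ g : G, (g : IsomHyp 5) • γ i = γ i → g ∈ A i
  /-- Two orthogonal 3-dimensional subspaces, whose intersection is a geodesic. -/
  S : Fin 2 → Set (Hyp 5)
  isHypSubspace_S : ∀ i, IsHypSubspace 3 (S i)
  S_inter_L : ∀ i, S i ∩ L = γ i
  isHypSubspace_S_inter_S : IsHypSubspace 1 (S 0 ∩ S 1)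
  orthogonal_S : MeetAtAngle (S 0 ∩ S 1) (S 0) (S 1) (Real.pi / 2)
  /-- The commuting involutions with fixed-point sets `S 0`, `S 1`. -/
  σ : Fin 2 → IsomHyp 5
  σ_mul_self : ∀ i, σ i * σ i = 1
  fixed_σ : ∀ i, {x : Hyp 5 | σ i • x = x} = S i
  σ_comm : σ 0 * σ 1 = σ 1 * σ 0
  /-- Conjugation by `σ i` fixes the edge group `A i`. -/
  σ_conj : ∀ i, ∀ a ∈ A i, σ i * (a : IsomHyp 5) * (σ i)⁻¹ = a

namespace QuadrilateralData

/-- The quadrilateral of groups: the vertex groups are copies of `G`, the edge joining the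
vertices `0, 1` and the edge joining `2, 3` carry copies of `A 1`, the edge joining `1, 2` and
the edge joining `3, 0` carry copies of `A 0`. -/
def quadrilateral (D : QuadrilateralData) : QuadrilateralOfGroups :=
  squareOfCopies D.A

/-- The isometries `1, σ₂, σ₁σ₂, σ₁` that carry `L = L₁` to `L₁, L₂, L₃, L₄`. -/
def corner (D : QuadrilateralData) : Fin 4 → IsomHyp 5 :=
  ![1, D.σ 1, D.σ 0 * D.σ 1, D.σ 0]

/-- The representation of a vertex group: the inclusion of `G` in the isometry group, followed
by conjugation by `1, σ₂, σ₁σ₂, σ₁` respectively. -/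
def vertexRep (D : QuadrilateralData) (i : Fin 4) : D.G →* IsomHyp 5 :=
  (MulAut.conj (D.corner i)).toMonoidHom.comp D.G.subtype

theorem vertexRep_compatible (D : QuadrilateralData) (i : Fin 4) (h : D.quadrilateral.edge i) :
    D.vertexRep i (D.quadrilateral.toFst i h) =
      D.vertexRep (i + 1) (D.quadrilateral.toSnd i h) := by
  have h0 := D.σ_conj 0
  have h1 := D.σ_conj 1
  have hc := D.σ_comm
  fin_cases i
  · obtain ⟨h, hh⟩ := h
    have e := h1 h hh
    change 1 * (h : IsomHyp 5) * 1⁻¹ = D.σ 1 * (h : IsomHyp 5) * (D.σ 1)⁻¹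
    rw [e]; simp
  · obtain ⟨h, hh⟩ := h
    have e := h0 h hh
    change D.σ 1 * (h : IsomHyp 5) * (D.σ 1)⁻¹ =
      D.σ 0 * D.σ 1 * (h : IsomHyp 5) * (D.σ 0 * D.σ 1)⁻¹
    conv_lhs => rw [← e]
    rw [hc]; group
  · obtain ⟨h, hh⟩ := h
    have e := h1 h hh
    change D.σ 0 * D.σ 1 * (h : IsomHyp 5) * (D.σ 0 * D.σ 1)⁻¹ =
      D.σ 0 * (h : IsomHyp 5) * (D.σ 0)⁻¹
    conv_rhs => rw [← e]
    group
  · obtain ⟨h, hh⟩ := h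
    have e := h0 h hh
    change D.σ 0 * (h : IsomHyp 5) * (D.σ 0)⁻¹ = 1 * (h : IsomHyp 5) * 1⁻¹
    rw [e]; simp

/-- The induced representation of the fundamental group of the quadrilateral of groups. -/
def rep (D : QuadrilateralData) : D.quadrilateral.FundamentalGroup →* IsomHyp 5 :=
  D.quadrilateral.lift D.vertexRep D.vertexRep_compatible

/-- The translates of the geodesics `γ 0` and `γ 1` under the group `G`. -/
def orbit (D : QuadrilateralData) : Set (Set (Hyp 5)) :=
  {β | ∃ g ∈ D.G, ∃ i, β = g • D.γ i}

/-- The separation conditions, with constants `R₀`, `R` and `R₁`. -/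
structure Separated (D : QuadrilateralData) (R₀ R R₁ : ℝ) : Prop where
  dist_eq : setDist (D.γ 0) (D.γ 1) = R₀
  lt : R₀ < R
  dist_orbit : ∀ β ∈ D.orbit, ∀ β' ∈ D.orbit, β ≠ β' →
    R ≤ setDist β β' ∨ ∃ g ∈ D.G, g • (β ∪ β') = D.γ 0 ∪ D.γ 1
  dist_proj : ∀ i, ∀ β ∈ D.orbit, ∀ β' ∈ D.orbit, β ≠ β' →
    setDist β (D.γ i) = R₀ → setDist β' (D.γ i) = R₀ →
    R₁ ≤ setDist (nearestProj (D.γ i) β) (nearestProj (D.γ i) β')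

end QuadrilateralData

/-! Adjoin the symmetries of the square to `G`. Every element of π₁(Q) then becomes a word in
conjugates by `G` of `σ 0`, `σ 1` and `σ 0 * σ 1`, followed by an element of `G`. A conjugate of `σ
i` means crossing a translate of `γ i` from one copy of `L` to the next; a conjugate of the product
means passing through the centre of a square to the opposite copy. A word is reduced if consecutive
letters share no geodesic and consecutive single crossings are at distance at least `R`. Any word
can be reduced: a shared crossing cancels, and two crossings of geodesics closer than `R` belong to
one square, where they commute and merge. The empty word lies in the vertex group, and a single
letter moves the corner of the square, so any other element of π₁(Q) is a word of length at least
two (`exists_reduced_word`).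

Such a word describes a broken path through copies of `L` with long segments, since `R` and `R₁` are
large. At a single crossing the path cannot backtrack, as `L` and `σ i • L` meet at a definite angle
(`coshDist_le_of_some`). At a double crossing it cannot, as `L` keeps away from the axis `S 0 ∩ S 1`
of the involution `σ 0 * σ 1` (`coshDist_le_of_involution`). Long segments with controlled turns
give a path that makes definite progress (`chain_estimate`), so a point of `L` is moved a definite
distance by every element outside the vertex group. With the discreteness of `G` this yields
faithfulness and discreteness (`injective_and_discrete`).

Lengths are measured by `coshDist`, so sums of distances become products, additive errors become
factors, and each inequality follows from the non-negativity of the Lorentz form on the complement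
of a point. -/

section Lorentz

/-! ### The Lorentz form and multiplicative distance inequalities. -/

variable {n : ℕ}

theorem lorentz_comm (x y : Fin (n + 1) → ℝ) : lorentz x y = lorentz y x := by
  simp only [lorentz, mul_comm]

theorem lorentz_add_left (x y z : Fin (n + 1) → ℝ) :
    lorentz (x + y) z = lorentz x z + lorentz y z := by
  simp only [lorentz, Pi.add_apply, add_mul, Finset.sum_add_distrib]; ring

theorem lorentz_smul_left (a : ℝ) (x y : Fin (n + 1) → ℝ) :
    lorentz (a • x) y = a * lorentz x y := by
  simp only [lorentz, Pi.smul_apply, smul_eq_mul, mul_add, Finset.mul_sum, mul_assoc, mul_neg]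

theorem lorentz_neg_left (x y : Fin (n + 1) → ℝ) : lorentz (-x) y = -lorentz x y := by
  rw [← neg_one_smul ℝ, lorentz_smul_left]; ring

theorem lorentz_sub_left (x y z : Fin (n + 1) → ℝ) :
    lorentz (x - y) z = lorentz x z - lorentz y z := by
  rw [sub_eq_add_neg, lorentz_add_left, lorentz_neg_left]; ring

theorem lorentz_add_right (x y z : Fin (n + 1) → ℝ) :
    lorentz x (y + z) = lorentz x y + lorentz x z := by
  rw [lorentz_comm, lorentz_add_left, lorentz_comm y, lorentz_comm z]

theorem lorentz_smul_right (a : ℝ) (x y : Fin (n + 1) → ℝ) :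
    lorentz x (a • y) = a * lorentz x y := by
  rw [lorentz_comm, lorentz_smul_left, lorentz_comm]

theorem lorentz_neg_right (x y : Fin (n + 1) → ℝ) : lorentz x (-y) = -lorentz x y := by
  rw [lorentz_comm, lorentz_neg_left, lorentz_comm]

theorem lorentz_sub_right (x y z : Fin (n + 1) → ℝ) :
    lorentz x (y - z) = lorentz x y - lorentz x z := by
  rw [lorentz_comm, lorentz_sub_left, lorentz_comm y, lorentz_comm z]

/-- The hyperbolic cosine of the distance. -/
def coshDist (x y : Hyp n) : ℝ := -lorentz x.vec y.vec

theorem Hyp.vec_injective : Function.Injective (Hyp.vec (n := n)) := Subtype.val_injective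

theorem Hyp.lorentz_self (x : Hyp n) : lorentz x.vec x.vec = -1 := x.2.1

theorem lorentz_vec (x y : Hyp n) : lorentz x.vec y.vec = -coshDist x y := (neg_neg _).symm

theorem coshDist_comm (x y : Hyp n) : coshDist x y = coshDist y x := by
  simp only [coshDist, lorentz_comm]

theorem coshDist_self (x : Hyp n) : coshDist x x = 1 := by
  simp [coshDist, x.lorentz_self]

theorem sum_sq_vec (x : Hyp n) : ∑ i : Fin n, x.vec i.succ ^ 2 = x.vec 0 ^ 2 - 1 := by
  have := x.lorentz_self
  simp only [lorentz] at this
  simp only [pow_two]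
  linarith

/-- Cauchy–Schwarz for the spatial coordinates. Bounding the whole spatial part of `u`, and not only
its sign, also settles when the form vanishes. -/
theorem lorentz_self_bound {p : Hyp n} {u : Fin (n + 1) → ℝ} (h : lorentz u p.vec = 0) :
    ∑ i : Fin n, u i.succ ^ 2 ≤ p.vec 0 ^ 2 * lorentz u u := by
  have hcs := Finset.sum_mul_sq_le_sq_mul_sq Finset.univ (fun i : Fin n => u i.succ)
    (fun i : Fin n => p.vec i.succ)
  rw [sum_sq_vec] at hcs
  have e1 : ∑ i : Fin n, u i.succ * p.vec i.succ = u 0 * p.vec 0 := by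
    simp only [lorentz] at h; linarith
  have e2 : lorentz u u = -(u 0 * u 0) + ∑ i : Fin n, u i.succ ^ 2 := by
    simp only [lorentz, pow_two]
  rw [e1] at hcs
  rw [e2]
  nlinarith

/-- Vectors orthogonal to a point of hyperbolic space are spacelike. -/
theorem lorentz_self_nonneg {p : Hyp n} {u : Fin (n + 1) → ℝ} (h : lorentz u p.vec = 0) :
    0 ≤ lorentz u u := by
  have h1 := lorentz_self_bound h
  have h2 : 0 ≤ ∑ i : Fin n, u i.succ ^ 2 := Finset.sum_nonneg fun i _ => sq_nonneg _
  have h3 : 0 < p.vec 0 := p.2.2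
  by_contra! h4
  nlinarith [mul_pos h3 h3]

theorem lorentz_self_pos {p : Hyp n} {u : Fin (n + 1) → ℝ} (h : lorentz u p.vec = 0)
    (hu : u ≠ 0) : 0 < lorentz u u := by
  refine lt_of_le_of_ne (lorentz_self_nonneg h) fun h0 => hu ?_
  have h1 := lorentz_self_bound h
  rw [← h0, mul_zero] at h1
  have h2 : ∑ i : Fin n, u i.succ ^ 2 = 0 :=
    le_antisymm h1 (Finset.sum_nonneg fun i _ => sq_nonneg _)
  have h3 : ∀ i : Fin n, u i.succ = 0 := fun i => by
    have := (Finset.sum_eq_zero_iff_of_nonneg (fun i _ => sq_nonneg _)).1 h2 i (Finset.mem_univ i)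
    exact pow_eq_zero_iff two_ne_zero |>.1 this
  have h4 : u 0 = 0 := by
    have : lorentz u p.vec = -(u 0 * p.vec 0) := by simp [lorentz, h3]
    rw [h] at this
    have h5 : u 0 * p.vec 0 = 0 := by linarith
    exact (mul_eq_zero.1 h5).resolve_right p.2.2.ne'
  funext i
  exact Fin.cases h4 h3 i

/-- The Cauchy-Schwarz inequality in the orthogonal complement of a point. -/
theorem lorentz_mul_self_le {p : Hyp n} {u v : Fin (n + 1) → ℝ} (hu : lorentz u p.vec = 0)
    (hv : lorentz v p.vec = 0) : lorentz u v ^ 2 ≤ lorentz u u * lorentz v v := by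
  have key : ∀ t : ℝ, 0 ≤ lorentz v v * (t * t) + (2 * lorentz u v) * t + lorentz u u := by
    intro t
    have h : lorentz (u + t • v) p.vec = 0 := by
      rw [lorentz_add_left, lorentz_smul_left, hu, hv]; ring
    have := lorentz_self_nonneg h
    simp only [lorentz_add_left, lorentz_add_right, lorentz_smul_left, lorentz_smul_right,
      lorentz_comm v u] at this
    linarith
  have := discrim_le_zero key
  simp only [discrim] at this
  linarith

theorem coshDist_pos (x y : Hyp n) : 0 < coshDist x y := by
  have hcs := Finset.sum_mul_sq_le_sq_mul_sq Finset.univ (fun i : Fin n => x.vec i.succ)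
    (fun i : Fin n => y.vec i.succ)
  rw [sum_sq_vec, sum_sq_vec] at hcs
  have hx : 0 < x.vec 0 := x.2.2
  have hy : 0 < y.vec 0 := y.2.2
  have sx : 0 ≤ x.vec 0 ^ 2 - 1 := by
    rw [← sum_sq_vec]; exact Finset.sum_nonneg fun i _ => sq_nonneg _
  have sy : 0 ≤ y.vec 0 ^ 2 - 1 := by
    rw [← sum_sq_vec]; exact Finset.sum_nonneg fun i _ => sq_nonneg _
  have : ∑ i : Fin n, x.vec i.succ * y.vec i.succ < x.vec 0 * y.vec 0 :=
    lt_of_pow_lt_pow_left₀ 2 (by positivity) (by nlinarith)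
  simp only [coshDist, lorentz]
  linarith

theorem one_le_coshDist (x y : Hyp n) : 1 ≤ coshDist x y := by
  have h : lorentz (y.vec - coshDist x y • x.vec) x.vec = 0 := by
    rw [lorentz_sub_left, lorentz_smul_left, x.lorentz_self, lorentz_vec, coshDist_comm]; ring
  have h1 := lorentz_self_nonneg h
  simp only [lorentz_sub_left, lorentz_sub_right, lorentz_smul_left, lorentz_smul_right,
    lorentz_vec, coshDist_self, coshDist_comm y x] at h1
  nlinarith [coshDist_pos x y]

/-- This is `cosh (s + t) ≤ 2 cosh s cosh t`. It comes from the norm of the combination of the three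
vectors that is orthogonal to `y` and gives `x` and `z` weights inverse to their distances from `y`.
-/
theorem coshDist_triangle (x y z : Hyp n) :
    coshDist x z ≤ 2 * coshDist x y * coshDist y z := by
  set a := coshDist x y with ha
  set b := coshDist y z with hb
  have a0 : 0 < a := coshDist_pos x y
  have b0 : 0 < b := coshDist_pos y z
  have h : lorentz (b • x.vec + a • z.vec - (2 * a * b) • y.vec) y.vec = 0 := by
    simp only [lorentz_sub_left, lorentz_add_left, lorentz_smul_left, lorentz_vec, coshDist_self,
      coshDist_comm z y, ← ha, ← hb]
    ring
  have h1 := lorentz_self_nonneg h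
  simp only [lorentz_sub_left, lorentz_sub_right, lorentz_add_left, lorentz_add_right,
    lorentz_smul_left, lorentz_smul_right, lorentz_vec, coshDist_self, coshDist_comm z y,
    coshDist_comm y x, coshDist_comm z x, ← ha, ← hb] at h1
  have h2 : 0 ≤ a * b * (2 * a * b - coshDist x z) := by nlinarith [sq_nonneg a, sq_nonneg b]
  have := nonneg_of_mul_nonneg_right h2 (mul_pos a0 b0)
  linarith

/-- The four-point inequality (Gromov hyperbolicity) in multiplicative form. -/
theorem coshDist_four_point (x y z w : Hyp n) :
    coshDist x z * coshDist y w ≤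
      2 * (coshDist x y * coshDist z w + coshDist x w * coshDist y z) := by
  set a := coshDist x w with ha
  set b := coshDist y w with hb
  set d := coshDist z w with hd
  have a0 : 0 < a := coshDist_pos x w
  have b0 : 0 < b := coshDist_pos y w
  have d0 : 0 < d := coshDist_pos z w
  -- Up to the factor `a * b * d` this is `x/a + z/d - 2y/b`. It is orthogonal to `w` because each
  -- point is divided by its own `coshDist` to `w`.
  have h : lorentz ((b * d) • x.vec + (a * b) • z.vec - (2 * a * d) • y.vec) w.vec = 0 := by
    simp only [lorentz_sub_left, lorentz_add_left, lorentz_smul_left, lorentz_vec,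
      ← ha, ← hb, ← hd]
    ring
  have h1 := lorentz_self_nonneg h
  simp only [lorentz_sub_left, lorentz_sub_right, lorentz_add_left, lorentz_add_right,
    lorentz_smul_left, lorentz_smul_right, lorentz_vec, coshDist_self, coshDist_comm z y,
    coshDist_comm y x, coshDist_comm z x] at h1
  have h2 : 0 ≤ (a * b * d) * (2 * (coshDist x y * d + a * coshDist y z) - coshDist x z * b) := by
    nlinarith [sq_nonneg (b * d), sq_nonneg (a * b), sq_nonneg (a * d)]
  have := nonneg_of_mul_nonneg_right h2 (by positivity)
  linarith

/-- A future timelike vector is a positive multiple of a point of hyperbolic space. -/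
theorem exists_smul_vec {v : Fin (n + 1) → ℝ} {p : Hyp n} (hv : lorentz v v < 0)
    (hp : lorentz v p.vec < 0) :
    ∃ (x : Hyp n) (t : ℝ), 0 < t ∧ t ^ 2 = -lorentz v v ∧ v = t • x.vec := by
  set t := Real.sqrt (-lorentz v v) with ht
  have t0 : 0 < t := Real.sqrt_pos.2 (by linarith)
  have t2 : t ^ 2 = -lorentz v v := Real.sq_sqrt (by linarith)
  have hw : lorentz (t⁻¹ • v) (t⁻¹ • v) = -1 := by
    rw [lorentz_smul_left, lorentz_smul_right]
    field_simp
    linarith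
  have hw' : lorentz (t⁻¹ • v) p.vec < 0 := by
    rw [lorentz_smul_left]
    exact mul_neg_of_pos_of_neg (by positivity) hp
  have hpos : 0 < (t⁻¹ • v) 0 := by
    set w := t⁻¹ • v
    by_contra! h0
    have hs : 0 ≤ ∑ i : Fin n, w i.succ * w i.succ :=
      Finset.sum_nonneg fun i _ => mul_self_nonneg _
    have h1 : w 0 ≠ 0 := by
      intro h1
      simp only [lorentz, h1] at hw
      linarith
    let y : Hyp n := ⟨-w, by rw [lorentz_neg_left, lorentz_neg_right, neg_neg, hw], by
      simpa using lt_of_le_of_ne h0 h1⟩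
    have h2 := coshDist_pos y p
    have h3 : coshDist y p = lorentz w p.vec := by
      show -lorentz (-w) p.vec = _
      rw [lorentz_neg_left, neg_neg]
    linarith
  refine ⟨⟨t⁻¹ • v, hw, hpos⟩, t, t0, t2, ?_⟩
  show v = t • (t⁻¹ • v)
  rw [smul_smul, mul_inv_cancel₀ t0.ne', one_smul]

/-- A point of hyperbolic space can be moved a little in any direction. -/
theorem exists_add_smul_vec (p : Hyp n) (v : Fin (n + 1) → ℝ) :
    ∃ (x : Hyp n) (t e : ℝ), 0 < t ∧ 0 < e ∧ p.vec + e • v = t • x.vec := by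
  set a := lorentz p.vec v
  set b := lorentz v v
  have hd : 0 < 2 * |a| + |b| + 1 := by positivity
  -- Small enough for `p.vec + e • v` to stay timelike and to pair negatively with `p`.
  set e := (2 * |a| + |b| + 1)⁻¹ with he
  have e0 : 0 < e := inv_pos.2 hd
  have e1 : e * (2 * |a| + |b|) = 1 - e := by
    have : e * (2 * |a| + |b| + 1) = 1 := inv_mul_cancel₀ hd.ne'
    linarith
  have e2 : e ≤ 1 := inv_le_one_of_one_le₀ (by linarith [abs_nonneg a, abs_nonneg b])
  have ha := mul_le_mul_of_nonneg_left (le_abs_self a) e0.le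
  have hb := mul_le_mul_of_nonneg_left (le_abs_self b) e0.le
  have hb' : e * (e * b) ≤ e * |b| := by
    calc e * (e * b) ≤ e * (e * |b|) := mul_le_mul_of_nonneg_left hb e0.le
      _ ≤ 1 * (e * |b|) := mul_le_mul_of_nonneg_right e2 (by positivity)
      _ = e * |b| := one_mul _
  have h0 : 0 ≤ e * |a| := by positivity
  have h0' : 0 ≤ e * |b| := by positivity
  obtain ⟨x, t, t0, -, h⟩ := exists_smul_vec (v := p.vec + e • v) (p := p) (by
      simp only [lorentz_add_left, lorentz_add_right, lorentz_smul_left, lorentz_smul_right,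
        p.lorentz_self, lorentz_comm v p.vec]
      linarith) (by
      simp only [lorentz_add_left, lorentz_smul_left, p.lorentz_self, lorentz_comm v p.vec]
      linarith)
  exact ⟨x, t, e, t0, e0, h⟩

end Lorentz

/-! ### Isometries, and distances between sets. -/

section Isometries

variable {n : ℕ}

theorem vec_smul (g : IsomHyp n) (x : Hyp n) : (g • x).vec = g.1.1.mulVec x.vec := rfl

theorem coshDist_smul (g : IsomHyp n) (x y : Hyp n) :
    coshDist (g • x) (g • y) = coshDist x y := by
  simp only [coshDist, vec_smul, g.2.1]

theorem hypDist_eq (x y : Hyp n) : hypDist x y = Real.arcosh (coshDist x y) := rfl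

theorem cosh_hypDist (x y : Hyp n) : Real.cosh (hypDist x y) = coshDist x y :=
  Real.cosh_arcosh (one_le_coshDist x y)

theorem hypDist_nonneg (x y : Hyp n) : 0 ≤ hypDist x y :=
  Real.arcosh_nonneg (one_le_coshDist x y)

theorem hypDist_le_iff {x y z w : Hyp n} :
    hypDist x y ≤ hypDist z w ↔ coshDist x y ≤ coshDist z w := by
  rw [← cosh_hypDist, ← cosh_hypDist, Real.cosh_le_cosh, abs_of_nonneg (hypDist_nonneg _ _),
    abs_of_nonneg (hypDist_nonneg _ _)]

theorem setDist_le {A B : Set (Hyp n)} {x y : Hyp n} (hx : x ∈ A) (hy : y ∈ B) :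
    setDist A B ≤ hypDist x y :=
  csInf_le ⟨0, by rintro _ ⟨x, -, y, -, rfl⟩; exact hypDist_nonneg x y⟩ ⟨x, hx, y, hy, rfl⟩

theorem cosh_le_coshDist {A B : Set (Hyp n)} {x y : Hyp n} {R : ℝ} (hR : 0 ≤ R)
    (h : R ≤ setDist A B) (hx : x ∈ A) (hy : y ∈ B) : Real.cosh R ≤ coshDist x y := by
  have h1 := h.trans (setDist_le hx hy)
  rw [← cosh_hypDist, Real.cosh_le_cosh, abs_of_nonneg hR, abs_of_nonneg (hypDist_nonneg _ _)]
  exact h1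

theorem setDist_comm (A B : Set (Hyp n)) : setDist A B = setDist B A := by
  have h : ∀ x y : Hyp n, hypDist x y = hypDist y x := fun x y => by
    simp only [hypDist_eq, coshDist_comm]
  unfold setDist
  congr 1
  ext d
  constructor <;>
  · rintro ⟨x, hx, y, hy, rfl⟩
    exact ⟨y, hy, x, hx, h _ _⟩

theorem setDist_smul (g : IsomHyp n) (A B : Set (Hyp n)) :
    setDist (g • A) (g • B) = setDist A B := by
  unfold setDist
  congr 1
  ext d
  constructor
  · rintro ⟨_, ⟨x, hx, rfl⟩, _, ⟨y, hy, rfl⟩, rfl⟩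
    exact ⟨x, hx, y, hy, by simp only [hypDist_eq, coshDist_smul]⟩
  · rintro ⟨x, hx, y, hy, rfl⟩
    exact ⟨g • x, ⟨x, hx, rfl⟩, g • y, ⟨y, hy, rfl⟩, by simp only [hypDist_eq, coshDist_smul]⟩

theorem exists_coshDist_lt {A B : Set (Hyp n)} (hA : A.Nonempty) (hB : B.Nonempty) {R : ℝ}
    (h : setDist A B < R) : ∃ x ∈ A, ∃ y ∈ B, coshDist x y < Real.cosh R := by
  obtain ⟨a, ha⟩ := hA
  obtain ⟨b, hb⟩ := hB
  obtain ⟨_, ⟨x, hx, y, hy, rfl⟩, hd⟩ := exists_lt_of_csInf_lt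
    (s := {d | ∃ x ∈ A, ∃ y ∈ B, d = hypDist x y}) ⟨_, a, ha, b, hb, rfl⟩ h
  refine ⟨x, hx, y, hy, ?_⟩
  rw [← cosh_hypDist, Real.cosh_lt_cosh, abs_of_nonneg (hypDist_nonneg _ _)]
  exact hd.trans_le (le_abs_self R)

end Isometries

/-! ### Geodesics and projections to them. -/

section Subspaces

variable {n : ℕ}

/-- The subspace is determined by its points in hyperbolic space. -/
theorem vec_mem_of_forall {A : Set (Hyp n)} (hA : A.Nonempty)
    {V W : Submodule ℝ (Fin (n + 1) → ℝ)} (hV : A = {x | x.vec ∈ V})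
    (hW : ∀ x ∈ A, x.vec ∈ W) : V ≤ W := by
  intro v hv
  obtain ⟨p, hp⟩ := hA
  obtain ⟨x, t, e, t0, e0, h⟩ := exists_add_smul_vec p v
  have hpV : p.vec ∈ V := by rw [hV] at hp; exact hp
  have hx : x ∈ A := by
    rw [hV]
    have h1 : x.vec = t⁻¹ • (p.vec + e • v) := by
      rw [h, smul_smul, inv_mul_cancel₀ t0.ne', one_smul]
    show x.vec ∈ V
    rw [h1]
    exact V.smul_mem _ (V.add_mem hpV (V.smul_mem _ hv))
  have h1 : v = e⁻¹ • (t • x.vec - p.vec) := by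
    rw [← h, add_sub_cancel_left, smul_smul, inv_mul_cancel₀ e0.ne', one_smul]
  rw [h1]
  exact W.smul_mem _ (W.sub_mem (W.smul_mem _ (hW x hx)) (hW p hp))

/-- `f` is the orthogonal projection of `q` to `B`. -/
def IsFoot (B : Set (Hyp n)) (q f : Hyp n) : Prop :=
  f ∈ B ∧ ∀ z ∈ B, coshDist q z = coshDist q f * coshDist f z

theorem IsHypSubspace.exists_basis {B : Set (Hyp n)} (hB : IsHypSubspace 1 B) {p : Hyp n}
    (hp : p ∈ B) : ∃ e : Fin (n + 1) → ℝ, lorentz e p.vec = 0 ∧ 0 < lorentz e e ∧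
      B = {x | x.vec ∈ Submodule.span ℝ {p.vec, e}} := by
  obtain ⟨-, V, hV, rfl⟩ := hB
  have hp0 : p.vec ≠ 0 := by
    intro h
    have := p.lorentz_self
    rw [h, ← zero_smul ℝ (0 : Fin (n + 1) → ℝ), lorentz_smul_left] at this
    norm_num at this
  have hlt : Submodule.span ℝ {p.vec} < V := by
    refine lt_of_le_of_ne ((Submodule.span_singleton_le_iff_mem _ _).2 hp) ?_
    intro h
    rw [← h, finrank_span_singleton hp0] at hV
    norm_num at hV
  obtain ⟨e', he', hne⟩ := SetLike.exists_of_lt hlt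
  set e := e' + lorentz e' p.vec • p.vec with he
  have h1 : lorentz e p.vec = 0 := by
    rw [he, lorentz_add_left, lorentz_smul_left, p.lorentz_self]; ring
  have heV : e ∈ V := V.add_mem he' (V.smul_mem _ hp)
  have hne' : e ∉ Submodule.span ℝ {p.vec} := by
    intro h
    apply hne
    have : e' = e - lorentz e' p.vec • p.vec := by rw [he]; abel
    rw [this]
    exact Submodule.sub_mem _ h (Submodule.smul_mem _ _ (Submodule.mem_span_singleton_self _))
  have he0 : e ≠ 0 := fun h => hne' (by rw [h]; exact Submodule.zero_mem _)
  refine ⟨e, h1, lorentz_self_pos h1 he0, ?_⟩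
  have hli : LinearIndependent ℝ ![p.vec, e] := by
    rw [LinearIndependent.pair_iff' hp0]
    intro a ha
    exact hne' (by rw [← ha]; exact Submodule.smul_mem _ _ (Submodule.mem_span_singleton_self _))
  have hfin : Module.finrank ℝ (Submodule.span ℝ {p.vec, e}) = 2 := by
    have hr : Set.range ![p.vec, e] = {p.vec, e} := by
      rw [Matrix.range_cons, Matrix.range_cons, Matrix.range_empty, Set.union_empty,
        Set.singleton_union]
    rw [← hr, finrank_span_eq_card hli, Fintype.card_fin]
  have : Submodule.span ℝ {p.vec, e} = V := by
    apply Submodule.eq_of_le_of_finrank_eq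
    · rw [Submodule.span_le]
      rintro x (rfl | rfl)
      · exact hp
      · exact heV
    · rw [hfin, hV]
  rw [this]

/-- The foot is the normalized Lorentz-orthogonal projection `v` of `q` to the plane of `B`. As `q -
v` is orthogonal to a point of `B`, it is not timelike, which forces `lorentz v v ≤ -1`. -/
theorem IsHypSubspace.exists_foot {B : Set (Hyp n)} (hB : IsHypSubspace 1 B) (q : Hyp n) :
    ∃ f, IsFoot B q f := by
  obtain ⟨p, hp⟩ := hB.1
  obtain ⟨e, hep, hee, hBe⟩ := hB.exists_basis hp
  set V := Submodule.span ℝ {p.vec, e}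
  have hpV : p.vec ∈ V := Submodule.subset_span (by simp)
  have heV : e ∈ V := Submodule.subset_span (by simp)
  set v := coshDist q p • p.vec + (lorentz q.vec e / lorentz e e) • e with hv
  have hvV : v ∈ V := V.add_mem (V.smul_mem _ hpV) (V.smul_mem _ heV)
  have horth : ∀ z ∈ V, lorentz v z = lorentz q.vec z := by
    intro z hz
    obtain ⟨a, b, rfl⟩ := Submodule.mem_span_pair.1 hz
    simp only [hv, lorentz_add_left, lorentz_add_right, lorentz_smul_left, lorentz_smul_right,
      p.lorentz_self, hep, lorentz_comm p.vec e, lorentz_vec]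
    field_simp
    ring
  have h1 : lorentz (q.vec - v) p.vec = 0 := by
    rw [lorentz_sub_left, horth _ hpV, sub_self]
  have h2 := lorentz_self_nonneg h1
  have h3 : lorentz v q.vec = lorentz v v := by rw [lorentz_comm, horth v hvV]
  rw [lorentz_sub_left, lorentz_sub_right, lorentz_sub_right, q.lorentz_self,
    lorentz_comm q.vec, h3] at h2
  obtain ⟨f, t, t0, ht, hf⟩ := exists_smul_vec (v := v) (p := p) (by linarith) (by
    rw [horth _ hpV, lorentz_vec]; linarith [coshDist_pos q p])
  have hc : ∀ z ∈ B, coshDist q z = t * coshDist f z := by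
    intro z hz
    rw [hBe] at hz
    have := horth _ hz
    rw [hf, lorentz_smul_left, lorentz_vec, lorentz_vec] at this
    linarith
  have hfB : f ∈ B := by
    rw [hBe]
    have : f.vec = t⁻¹ • v := by rw [hf, smul_smul, inv_mul_cancel₀ t0.ne', one_smul]
    show f.vec ∈ V
    rw [this]
    exact V.smul_mem _ hvV
  refine ⟨f, hfB, fun z hz => ?_⟩
  rw [hc z hz, hc f hfB, coshDist_self, mul_one]

theorem IsFoot.mem_nearestProj {A B : Set (Hyp n)} {q f : Hyp n} (h : IsFoot A q f)
    (hq : q ∈ B) : f ∈ nearestProj A B := by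
  refine ⟨h.1, q, hq, fun z hz => ?_⟩
  rw [hypDist_le_iff, h.2 z hz]
  exact le_mul_of_one_le_right (coshDist_pos _ _).le (one_le_coshDist _ _)

theorem IsFoot.smul {B : Set (Hyp n)} {q f : Hyp n} (h : IsFoot B q f) (g : IsomHyp n) :
    IsFoot (g • B) (g • q) (g • f) := by
  refine ⟨Set.smul_mem_smul_set h.1, ?_⟩
  rintro _ ⟨z, hz, rfl⟩
  simp only [coshDist_smul]
  exact h.2 z hz

/-- Projecting from one geodesic to another one, back and forth, stabilizes at once up to a
bounded error. -/
theorem IsFoot.coshDist_sq_le {A B : Set (Hyp n)} {p q p' q' : Hyp n} (hp : p ∈ A)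
    (hq : IsFoot B p q) (hp' : IsFoot A q p') (hq' : IsFoot B p' q') :
    coshDist q q' ^ 2 ≤ 2 := by
  have h1 := hq.2 q' hq'.1
  have h2 := hp'.2 p hp
  have h3 := hq'.2 q hq.1
  have h4 := coshDist_triangle p p' q'
  have a0 := coshDist_pos p p'
  have b0 := coshDist_pos p' q'
  -- The three right-angle identities turn the distance from `p` to `q'` into the product of those
  -- of `p, p'`, of `p', q'` and the square of that of `q, q'`; the triangle inequality bounds it by
  -- twice the first two factors.
  rw [h1, coshDist_comm p q, h2, coshDist_comm q p', h3, coshDist_comm q' q,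
    coshDist_comm p' p] at h4
  have : 0 ≤ (coshDist p p' * coshDist p' q') * (2 - coshDist q q' ^ 2) := by linarith
  have := nonneg_of_mul_nonneg_right this (mul_pos a0 b0)
  linarith

/-- Two points determine a geodesic. -/
theorem IsHypSubspace.eq_of_mem {A B : Set (Hyp n)} (hA : IsHypSubspace 1 A)
    (hB : IsHypSubspace 1 B) {p q : Hyp n} (hpq : p ≠ q) (hpA : p ∈ A) (hqA : q ∈ A)
    (hpB : p ∈ B) (hqB : q ∈ B) : A = B := by
  have key : ∀ C : Set (Hyp n), IsHypSubspace 1 C → p ∈ C → q ∈ C →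
      C = {x | x.vec ∈ Submodule.span ℝ {p.vec, q.vec}} := by
    intro C hC hp hq
    obtain ⟨e, hep, hee, hCe⟩ := hC.exists_basis hp
    rw [hCe]
    have hqV : q.vec ∈ Submodule.span ℝ {p.vec, e} := by rw [hCe] at hq; exact hq
    obtain ⟨a, b, hab⟩ := Submodule.mem_span_pair.1 hqV
    have hb : b ≠ 0 := by
      rintro rfl
      rw [zero_smul, add_zero] at hab
      have h1 := q.lorentz_self
      rw [← hab, lorentz_smul_left, lorentz_smul_right, p.lorentz_self] at h1
      have h2 := coshDist_pos q p
      rw [coshDist, ← hab, lorentz_smul_left, p.lorentz_self] at h2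
      have h3 : a = 1 := by nlinarith
      rw [h3, one_smul] at hab
      exact hpq (Hyp.vec_injective hab)
    have : Submodule.span ℝ {p.vec, e} = Submodule.span ℝ {p.vec, q.vec} := by
      apply le_antisymm
      · rw [Submodule.span_le]
        rintro x (rfl | rfl)
        · exact Submodule.subset_span (by simp)
        · refine Submodule.mem_span_pair.2 ⟨-(b⁻¹ * a), b⁻¹, ?_⟩
          rw [← hab, smul_add, smul_smul, smul_smul, inv_mul_cancel₀ hb]
          simp
      · rw [Submodule.span_le]
        rintro x (rfl | rfl)
        · exact Submodule.subset_span (by simp)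
        · exact hqV
    rw [this]
  rw [key A hA hpA hqA, key B hB hpB hqB]

/-- A geodesic contains three distinct points. -/
theorem IsHypSubspace.exists_three {A : Set (Hyp n)} (hA : IsHypSubspace 1 A) :
    ∃ p ∈ A, ∃ q ∈ A, ∃ s ∈ A, p ≠ q ∧ p ≠ s ∧ q ≠ s := by
  obtain ⟨p, hp⟩ := hA.1
  obtain ⟨e, hep, hee, hAe⟩ := hA.exists_basis hp
  obtain ⟨x, t, d, t0, d0, h⟩ := exists_add_smul_vec p e
  obtain ⟨y, t', d', t0', d0', h'⟩ := exists_add_smul_vec p (-e)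
  have hep' : lorentz p.vec e = 0 := by rw [lorentz_comm, hep]
  have hmem : ∀ (z : Hyp n) (t a b : ℝ), 0 < t → a • p.vec + b • e = t • z.vec → z ∈ A := by
    intro z t a b ht hz
    rw [hAe]
    refine Submodule.mem_span_pair.2 ⟨t⁻¹ * a, t⁻¹ * b, ?_⟩
    rw [mul_smul, mul_smul, ← smul_add, hz, smul_smul, inv_mul_cancel₀ ht.ne', one_smul]
  have h1 : 0 < lorentz x.vec e := by
    have : lorentz (p.vec + d • e) e = t * lorentz x.vec e := by rw [h, lorentz_smul_left]
    rw [lorentz_add_left, lorentz_smul_left, hep', zero_add] at this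
    exact pos_of_mul_pos_right (this ▸ mul_pos d0 hee) t0.le
  have h2 : 0 < -lorentz y.vec e := by
    have : lorentz (p.vec + d' • (-e)) e = t' * lorentz y.vec e := by rw [h', lorentz_smul_left]
    rw [lorentz_add_left, lorentz_smul_left, lorentz_neg_left, hep', zero_add] at this
    have h3 := mul_pos d0' hee
    refine pos_of_mul_pos_right (a := t') ?_ t0'.le
    linarith
  refine ⟨p, hp, x, hmem x t 1 d t0 (by rw [one_smul, h]), y,
    hmem y t' 1 (-d') t0' (by rw [one_smul, ← h', smul_neg, neg_smul]), ?_, ?_, ?_⟩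
  · rintro rfl; linarith
  · rintro rfl; linarith
  · rintro rfl; linarith

/-- Pigeonhole: of three points of `A`, two lie on the same one of the other geodesics. -/
theorem IsHypSubspace.eq_or_eq_of_subset_union {A B C : Set (Hyp n)} (hA : IsHypSubspace 1 A)
    (hB : IsHypSubspace 1 B) (hC : IsHypSubspace 1 C) (h : A ⊆ B ∪ C) : A = B ∨ A = C := by
  obtain ⟨p, hp, q, hq, s, hs, hpq, hps, hqs⟩ := hA.exists_three
  rcases h hp with hp' | hp' <;> rcases h hq with hq' | hq' <;> rcases h hs with hs' | hs'
  · exact .inl (hA.eq_of_mem hB hpq hp hq hp' hq')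
  · exact .inl (hA.eq_of_mem hB hpq hp hq hp' hq')
  · exact .inl (hA.eq_of_mem hB hps hp hs hp' hs')
  · exact .inr (hA.eq_of_mem hC hqs hq hs hq' hs')
  · exact .inl (hA.eq_of_mem hB hqs hq hs hq' hs')
  · exact .inr (hA.eq_of_mem hC hps hp hs hp' hs')
  · exact .inr (hA.eq_of_mem hC hpq hp hq hp' hq')
  · exact .inr (hA.eq_of_mem hC hpq hp hq hp' hq')

theorem IsHypSubspace.smul {k : ℕ} {A : Set (Hyp n)} (hA : IsHypSubspace k A) (g : IsomHyp n) :
    IsHypSubspace k (g • A) := by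
  obtain ⟨hne, V, hV, rfl⟩ := hA
  refine ⟨hne.smul_set, ?_⟩
  let e : (Fin (n + 1) → ℝ) ≃ₗ[ℝ] (Fin (n + 1) → ℝ) :=
    LinearEquiv.ofLinearMap (Matrix.mulVecLin g.1.1) (Matrix.mulVecLin (g⁻¹).1.1)
      (by
        rw [← Matrix.mulVecLin_mul, ← Units.val_mul, ← Subgroup.coe_mul, mul_inv_cancel]
        exact Matrix.mulVecLin_one)
      (by
        rw [← Matrix.mulVecLin_mul, ← Units.val_mul, ← Subgroup.coe_mul, inv_mul_cancel]
        exact Matrix.mulVecLin_one)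
  refine ⟨V.map e.toLinearMap, by rw [← hV]; exact LinearEquiv.finrank_map_eq e V, ?_⟩
  ext x
  rw [Set.mem_smul_set_iff_inv_smul_mem]
  show e.symm x.vec ∈ V ↔ x.vec ∈ V.map e.toLinearMap
  exact (Submodule.mem_map_equiv V).symm

end Subspaces

/-! ### Estimates for crossing a geodesic and for crossing a square. -/

section Doors

variable {n : ℕ}

theorem IsFoot.lorentz_sub_eq_zero {B : Set (Hyp n)} {q f : Hyp n} (h : IsFoot B q f)
    {z : Hyp n} (hz : z ∈ B) : lorentz (q.vec - coshDist q f • f.vec) z.vec = 0 := by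
  rw [lorentz_sub_left, lorentz_smul_left, lorentz_vec, lorentz_vec, h.2 z hz]
  ring

theorem IsFoot.lorentz_sub_self {B : Set (Hyp n)} {q f : Hyp n} (h : IsFoot B q f) :
    lorentz (q.vec - coshDist q f • f.vec) (q.vec - coshDist q f • f.vec) =
      coshDist q f ^ 2 - 1 := by
  rw [lorentz_sub_right, lorentz_smul_right, h.lorentz_sub_eq_zero h.1, lorentz_sub_left,
    lorentz_smul_left, lorentz_vec, lorentz_vec, coshDist_self, coshDist_comm f q]
  ring

/-- Capping the angle at `π / 2` makes the cosine non-negative. The norms of `u` and `v` may then be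
replaced by upper bounds, and null vectors need no angle. -/
theorem lorentz_le_of_meetAtAngle {A B C : Set (Hyp n)} {α : ℝ} (h : MeetAtAngle C A B α)
    (hC : C.Nonempty) {u v : Fin (n + 1) → ℝ} (hu : u ∈ linSpan A) (hv : v ∈ linSpan B)
    (huC : ∀ x ∈ C, lorentz u x.vec = 0) (hvC : ∀ x ∈ C, lorentz v x.vec = 0) {a b : ℝ}
    (ha : 0 < a) (hb : 0 < b) (hua : lorentz u u ≤ a ^ 2) (hvb : lorentz v v ≤ b ^ 2) :
    lorentz u v ≤ Real.cos (min α (Real.pi / 2)) * (a * b) ∨ α ≤ 0 := by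
  by_cases hα : α ≤ 0
  · exact .inr hα
  push Not at hα
  left
  obtain ⟨p, hp⟩ := hC
  set β := min α (Real.pi / 2) with hβ
  have β0 : 0 < β := lt_min hα (by positivity)
  have β1 : β ≤ Real.pi / 2 := min_le_right _ _
  have hcos : 0 ≤ Real.cos β := Real.cos_nonneg_of_neg_pi_div_two_le_of_le (by linarith) β1
  have hcs := lorentz_mul_self_le (huC p hp) (hvC p hp)
  have hu0 := lorentz_self_nonneg (huC p hp)
  have hv0 := lorentz_self_nonneg (hvC p hp)
  have hab : 0 ≤ Real.cos β * (a * b) := by positivity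
  rcases hu0.eq_or_lt with hu1 | hu1
  · have : lorentz u v = 0 := by
      rw [← hu1, zero_mul] at hcs
      exact pow_eq_zero_iff two_ne_zero |>.1 (le_antisymm hcs (sq_nonneg _))
    rwa [this]
  rcases hv0.eq_or_lt with hv1 | hv1
  · have : lorentz u v = 0 := by
      rw [← hv1, mul_zero] at hcs
      exact pow_eq_zero_iff two_ne_zero |>.1 (le_antisymm hcs (sq_nonneg _))
    rwa [this]
  set s := Real.sqrt (lorentz u u) with hs
  set t := Real.sqrt (lorentz v v) with ht
  have s0 : 0 < s := Real.sqrt_pos.2 hu1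
  have t0 : 0 < t := Real.sqrt_pos.2 hv1
  have s2 : s ^ 2 = lorentz u u := Real.sq_sqrt hu1.le
  have t2 : t ^ 2 = lorentz v v := Real.sq_sqrt hv1.le
  have sa : s ≤ a := abs_le_of_sq_le_sq' (by linarith) ha.le |>.2
  have tb : t ≤ b := abs_le_of_sq_le_sq' (by linarith) hb.le |>.2
  have key := h (s⁻¹ • u) (Submodule.smul_mem _ _ hu) (t⁻¹ • v) (Submodule.smul_mem _ _ hv)
    (fun x hx => by rw [lorentz_smul_left, huC x hx, mul_zero])
    (fun x hx => by rw [lorentz_smul_left, hvC x hx, mul_zero])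
    (by rw [lorentz_smul_left, lorentz_smul_right, ← s2]; field_simp)
    (by rw [lorentz_smul_left, lorentz_smul_right, ← t2]; field_simp)
  rw [lorentz_smul_left, lorentz_smul_right] at key
  set c := s⁻¹ * (t⁻¹ * lorentz u v) with hc
  have hcuv : lorentz u v = c * (s * t) := by rw [hc]; field_simp
  have hc1 : c ^ 2 ≤ 1 := by
    rw [hcuv, ← s2, ← t2] at hcs
    have : 0 ≤ (s * t) ^ 2 * (1 - c ^ 2) := by linarith
    have := nonneg_of_mul_nonneg_right this (by positivity)
    linarith
  have hc2 : c ≤ Real.cos β := by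
    rw [← Real.cos_arccos (by nlinarith : -1 ≤ c) (by nlinarith : c ≤ 1)]
    exact Real.cos_le_cos_of_nonneg_of_le_pi β0.le (Real.arccos_le_pi _)
      ((min_le_left _ _).trans key)
  rw [hcuv]
  calc c * (s * t) ≤ Real.cos β * (s * t) := mul_le_mul_of_nonneg_right hc2 (by positivity)
    _ ≤ Real.cos β * (a * b) := by gcongr

/-- Crossing a geodesic from `A` to `B` when `A` and `B` meet at a definite angle. -/
theorem coshDist_le_of_meetAtAngle {A B C : Set (Hyp n)} {α : ℝ} (hα : 0 < α)
    (h : MeetAtAngle C A B α) (hCA : C ⊆ A) (hCB : C ⊆ B) {y x z w : Hyp n} (hy : y ∈ A)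
    (hz : z ∈ B) (hx : IsFoot C y x) (hw : IsFoot C z w) :
    (1 - Real.cos (min α (Real.pi / 2))) * (coshDist y x * coshDist x w * coshDist w z) ≤
      coshDist y z := by
  have hspan : ∀ {D : Set (Hyp n)} {x : Hyp n}, x ∈ D → x.vec ∈ linSpan D := fun hx =>
    Submodule.subset_span ⟨_, hx, rfl⟩
  have a0 := coshDist_pos y x
  have b0 := coshDist_pos z w
  -- Let `u`, `v` be the parts of `y`, `z` normal to `C`. Then `coshDist y z` is the full product of
  -- the three factors minus `lorentz u v`, and the norms of `u`, `v` are at most the outer two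
  -- factors.
  have key := (lorentz_le_of_meetAtAngle h ⟨x, hx.1⟩
    (Submodule.sub_mem _ (hspan hy) (Submodule.smul_mem _ (coshDist y x) (hspan (hCA hx.1))))
    (Submodule.sub_mem _ (hspan hz) (Submodule.smul_mem _ (coshDist z w) (hspan (hCB hw.1))))
    (fun _ => hx.lorentz_sub_eq_zero) (fun _ => hw.lorentz_sub_eq_zero) a0 b0
    (by rw [hx.lorentz_sub_self]; linarith) (by rw [hw.lorentz_sub_self]; linarith)).resolve_right
    (not_le.2 hα)
  set k := Real.cos (min α (Real.pi / 2)) with hk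
  have hk0 : 0 ≤ k := Real.cos_nonneg_of_neg_pi_div_two_le_of_le
    ((by linarith [Real.pi_pos] : -(Real.pi / 2) ≤ 0).trans (lt_min hα (by positivity)).le)
    (min_le_right _ _)
  have e1 := hx.2 w hw.1
  have e2 := hw.2 x hx.1
  simp only [lorentz_sub_left, lorentz_sub_right, lorentz_smul_left, lorentz_smul_right,
    lorentz_vec, coshDist_comm x z, e1, e2, coshDist_comm w x] at key
  rw [coshDist_comm w z]
  have h1 := one_le_coshDist x w
  have h2 : 0 ≤ k * (coshDist y x * coshDist z w) * (coshDist x w - 1) :=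
    mul_nonneg (by positivity) (by linarith)
  linarith

theorem exists_mem_of_add {k : ℕ} {L : Set (Hyp n)} (hL : IsHypSubspace k L) {x y : Hyp n}
    (hx : x ∈ L) (hy : y ∈ L) {a b : ℝ} (ha : 0 < a) (hb : 0 < b) :
    ∃ z ∈ L, ∃ t : ℝ, 0 < t ∧ a • x.vec + b • y.vec = t • z.vec := by
  obtain ⟨-, V, -, rfl⟩ := hL
  have h0 := coshDist_pos x y
  have hab := mul_pos ha hb
  obtain ⟨z, t, t0, -, h⟩ := exists_smul_vec (v := a • x.vec + b • y.vec) (p := x) (by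
      simp only [lorentz_add_left, lorentz_add_right, lorentz_smul_left, lorentz_smul_right,
        lorentz_vec, coshDist_self, coshDist_comm y x]
      nlinarith) (by
      simp only [lorentz_add_left, lorentz_smul_left, lorentz_vec, coshDist_self,
        coshDist_comm y x]
      nlinarith)
  refine ⟨z, ?_, t, t0, h⟩
  show z.vec ∈ V
  have : z.vec = t⁻¹ • (a • x.vec + b • y.vec) := by
    rw [h, smul_smul, inv_mul_cancel₀ t0.ne', one_smul]
  rw [this]
  exact V.smul_mem _ (V.add_mem (V.smul_mem _ hx) (V.smul_mem _ hy))

/-- Half of the distance between `x` and its image under an involution is attained at a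
fixed point of the involution. -/
theorem exists_fixed_of_involution {τ : IsomHyp n} (hτ : τ * τ = 1) (x : Hyp n) :
    ∃ (f : Hyp n) (t : ℝ), 0 < t ∧ τ • f = f ∧ x.vec + (τ • x).vec = t • f.vec ∧
      t ^ 2 = 2 * (coshDist x (τ • x) + 1) ∧ 2 * coshDist x f = t := by
  have h0 := coshDist_pos x (τ • x)
  obtain ⟨f, t, t0, ht, h⟩ := exists_smul_vec (v := x.vec + (τ • x).vec) (p := x) (by
      simp only [lorentz_add_left, lorentz_add_right, lorentz_vec, coshDist_self,
        coshDist_comm (τ • x) x]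
      linarith) (by
      simp only [lorentz_add_left, lorentz_vec, coshDist_self, coshDist_comm (τ • x) x]
      linarith)
  simp only [lorentz_add_left, lorentz_add_right, lorentz_vec, coshDist_self,
        coshDist_comm (τ • x) x] at ht
  refine ⟨f, t, t0, ?_, h, by linarith, ?_⟩
  · apply Hyp.vec_injective
    have h1 : f.vec = t⁻¹ • (x.vec + (τ • x).vec) := by
      rw [h, smul_smul, inv_mul_cancel₀ t0.ne', one_smul]
    have h2 : τ.1.1.mulVec (τ • x).vec = x.vec := by
      rw [← vec_smul, smul_smul, hτ, one_smul]
    rw [vec_smul, h1, Matrix.mulVec_smul, Matrix.mulVec_add, h2, ← vec_smul, add_comm (τ • x).vec]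
  · have h1 : lorentz x.vec (x.vec + (τ • x).vec) = t * lorentz x.vec f.vec := by
      rw [h, lorentz_smul_right]
    simp only [lorentz_add_right, lorentz_vec, coshDist_self] at h1
    have h2 : t * (2 * coshDist x f) = t * t := by linarith
    exact mul_left_cancel₀ t0.ne' h2

/-- If `L` stays away from the fixed points of an involution `τ`, then `L` and `τ L` diverge. -/
theorem coshDist_le_of_involution {k : ℕ} {L : Set (Hyp n)} (hL : IsHypSubspace k L)
    {τ : IsomHyp n} (hτ : τ * τ = 1) {r T : ℝ} (hr : 0 < r)
    (hd : ∀ f : Hyp n, τ • f = f → ∀ x ∈ L, Real.cosh (r / 2) ≤ coshDist f x) {m : Hyp n}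
    (hm : m ∈ L) (hT : coshDist m (τ • m) ≤ T) {y z : Hyp n} (hy : y ∈ L) (hz : z ∈ L) :
    coshDist y m * coshDist m (τ • m) * coshDist m z ≤
      16 * T ^ 2 / (2 * Real.sinh (r / 2) ^ 2 / T) ^ 4 * coshDist y (τ • z) := by
  set s := Real.sinh (r / 2) with hs
  have s0 : 0 < s := Real.sinh_pos_iff.2 (by linarith)
  have T1 : 1 ≤ T := (one_le_coshDist _ _).trans hT
  set κ := 2 * s ^ 2 / T with hκ
  have κ0 : 0 < κ := by positivity
  -- `N = 1 - τ` maps into the complement of the vectors fixed by `τ`, where the form is positive.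
  -- The squared norm of `N x` measures how far `τ` moves `x`.
  let N : (Fin (n + 1) → ℝ) →ₗ[ℝ] (Fin (n + 1) → ℝ) :=
    LinearMap.id - Matrix.mulVecLin τ.1.1
  have hN : ∀ x : Hyp n, N x.vec = x.vec - (τ • x).vec := fun x => rfl
  have hττ : ∀ x : Hyp n, τ • τ • x = x := fun x => by rw [smul_smul, hτ, one_smul]
  have hsym : ∀ x y : Hyp n, coshDist (τ • x) y = coshDist x (τ • y) := fun x y => by
    rw [← coshDist_smul τ, hττ]
  have hF : ∀ x y : Hyp n, lorentz (N x.vec) (N y.vec) =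
      2 * (coshDist x (τ • y) - coshDist x y) := fun x y => by
    simp only [hN, lorentz_sub_left, lorentz_sub_right, lorentz_vec, hsym, hττ]
    ring
  obtain ⟨o, -, -, ho, -, -, -⟩ := exists_fixed_of_involution hτ m
  have hNo : ∀ x : Hyp n, lorentz (N x.vec) o.vec = 0 := fun x => by
    simp only [hN, lorentz_sub_left, lorentz_vec, hsym, ho]
    ring
  have hcs : ∀ x y : Hyp n, lorentz (N x.vec) (N y.vec) ^ 2 ≤
      lorentz (N x.vec) (N x.vec) * lorentz (N y.vec) (N y.vec) := fun x y =>
    lorentz_mul_self_le (hNo x) (hNo y)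
  have hlow : ∀ x ∈ L, 4 * s ^ 2 ≤ lorentz (N x.vec) (N x.vec) := by
    intro x hx
    obtain ⟨f, t, t0, hf, -, ht, hxf⟩ := exists_fixed_of_involution hτ x
    have h1 := hd f hf x hx
    rw [coshDist_comm] at h1
    have h2 : Real.cosh (r / 2) ^ 2 = 1 + s ^ 2 := by rw [Real.cosh_sq, add_comm]
    rw [hF, coshDist_self]
    nlinarith [Real.cosh_pos (r / 2)]
  set ν : Hyp n → ℝ := fun x => Real.sqrt (lorentz (N x.vec) (N x.vec)) with hν
  have ν2 : ∀ x, ν x ^ 2 = lorentz (N x.vec) (N x.vec) := fun x =>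
    Real.sq_sqrt (lorentz_self_nonneg (hNo x))
  have ν0 : ∀ x ∈ L, 0 < ν x := fun x hx =>
    Real.sqrt_pos.2 (lt_of_lt_of_le (by positivity) (hlow x hx))
  have νnn : ∀ x, 0 ≤ ν x := fun x => Real.sqrt_nonneg _
  have hcs' : ∀ x y, lorentz (N x.vec) (N y.vec) ≤ ν x * ν y := fun x y => by
    have := hcs x y
    rw [← ν2, ← ν2, ← mul_pow] at this
    exact (abs_le_of_sq_le_sq' this (mul_nonneg (νnn x) (νnn y))).2
  have hadd : ∀ (x y u : Hyp n) (a b t : ℝ), a • x.vec + b • y.vec = t • u.vec →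
      t ^ 2 * lorentz (N u.vec) (N u.vec) = a ^ 2 * ν x ^ 2 + b ^ 2 * ν y ^ 2 +
        2 * a * b * lorentz (N x.vec) (N y.vec) := by
    intro x y u a b t h
    have h1 : t • N u.vec = a • N x.vec + b • N y.vec := by
      rw [← map_smul, ← h, map_add, map_smul, map_smul]
    have h2 : lorentz (t • N u.vec) (t • N u.vec) = t ^ 2 * lorentz (N u.vec) (N u.vec) := by
      rw [lorentz_smul_left, lorentz_smul_right]; ring
    rw [← h2, h1, ν2, ν2]
    simp only [lorentz_add_left, lorentz_add_right, lorentz_smul_left, lorentz_smul_right,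
      lorentz_comm (N y.vec) (N x.vec)]
    ring
  -- The displacement `ν` grows at a definite rate away from `m`. Otherwise, at the point `u`
  -- between `x` and `m` where the images under `N` have comparable weights, `ν` would drop below
  -- its lower bound on `L`.
  have hgrow : ∀ x ∈ L, κ * coshDist x m ≤ ν x := by
    intro x hx
    have x0 := ν0 x hx
    obtain ⟨u, hu, t, t0, h⟩ := exists_mem_of_add hL hx hm one_pos x0
    have h1 := hadd _ _ _ _ _ _ h
    have h2 := hlow u hu
    have h3 : lorentz (1 • x.vec + ν x • m.vec) (1 • x.vec + ν x • m.vec) = -t ^ 2 := by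
      rw [one_smul] at h ⊢
      rw [h, lorentz_smul_left, lorentz_smul_right, u.lorentz_self]; ring
    simp only [lorentz_add_left, lorentz_add_right, lorentz_smul_left, lorentz_smul_right,
      lorentz_vec, coshDist_self, coshDist_comm m x, one_smul] at h3
    have h4 : 2 * ν x * coshDist x m ≤ t ^ 2 := by nlinarith
    have h5 := mul_le_mul_of_nonneg_left h2 (sq_nonneg t)
    have h6 : 4 * s ^ 2 * (2 * ν x * coshDist x m) ≤ t ^ 2 * (4 * s ^ 2) := by
      nlinarith [sq_nonneg s]
    have h7 : t ^ 2 * lorentz (N u.vec) (N u.vec) ≤ ν x ^ 2 * (1 + ν m) ^ 2 := by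
      rw [h1]
      nlinarith [hcs' x m, mul_le_mul_of_nonneg_left (hcs' x m) x0.le]
    have h8 : (1 + ν m) ^ 2 ≤ 4 * T := by
      have : ν m ^ 2 = 2 * (coshDist m (τ • m) - 1) := by rw [ν2, hF, coshDist_self]
      nlinarith [sq_nonneg (1 - ν m)]
    have h9 : ν x ^ 2 * (1 + ν m) ^ 2 ≤ ν x ^ 2 * (4 * T) :=
      mul_le_mul_of_nonneg_left h8 (sq_nonneg _)
    have h10 : 0 ≤ (4 * ν x) * (ν x * T - 2 * s ^ 2 * coshDist x m) := by linarith
    have h11 := nonneg_of_mul_nonneg_right h10 (by positivity)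
    rw [hκ, div_mul_eq_mul_div, div_le_iff₀ (by linarith)]
    linarith
  have hup : ∀ x ∈ L, ν x ^ 2 ≤ 8 * T * coshDist x m ^ 2 := by
    intro x hx
    rw [ν2, hF, coshDist_self]
    have h1 := coshDist_triangle x m (τ • x)
    have h2 := coshDist_triangle m (τ • m) (τ • x)
    rw [coshDist_smul, coshDist_comm m x] at h2
    have c0 := coshDist_pos x m
    have h3 : coshDist x m * coshDist m (τ • x) ≤
        coshDist x m * (2 * T * coshDist x m) := by
      apply mul_le_mul_of_nonneg_left _ c0.le
      exact h2.trans (by gcongr)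
    nlinarith
  have y0 := ν0 y hy
  have z0 := ν0 z hz
  have Y0 := coshDist_pos y m
  have Z0 := coshDist_pos z m
  -- The weights `ν z`, `ν y` give the images of `y` and `z` under `N` equal norms. Growth of `ν` at
  -- the resulting point `u` then shows that these images are not nearly opposite.
  have hmain : 4 * κ ^ 4 * (coshDist y m * coshDist z m) ^ 2 ≤
      (2 * (ν y * ν z)) * (4 * coshDist y (τ • z)) := by
    obtain ⟨u, hu, t, t0, h⟩ := exists_mem_of_add hL hy hz z0 y0
    have h1 := hadd _ _ _ _ _ _ h
    have h2 := hgrow u hu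
    have h3 : ν z * coshDist y m + ν y * coshDist z m = t * coshDist u m := by
      have : lorentz (ν z • y.vec + ν y • z.vec) m.vec = t * lorentz u.vec m.vec := by
        rw [h, lorentz_smul_left]
      simp only [lorentz_add_left, lorentz_smul_left, lorentz_vec] at this
      linarith
    have h4 : 2 * κ * (coshDist y m * coshDist z m) ≤ t * coshDist u m := by
      rw [← h3]
      have g1 := mul_le_mul_of_nonneg_right (hgrow z hz) Y0.le
      have g2 := mul_le_mul_of_nonneg_right (hgrow y hy) Z0.le
      linarith
    have h5 : κ * (2 * κ * (coshDist y m * coshDist z m)) ≤ t * ν u := by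
      have g1 := mul_le_mul_of_nonneg_left h4 κ0.le
      have g2 := mul_le_mul_of_nonneg_left h2 t0.le
      linarith
    have h6 : (κ * (2 * κ * (coshDist y m * coshDist z m))) ^ 2 ≤ (t * ν u) ^ 2 := by
      gcongr
    rw [mul_pow t, ν2, h1] at h6
    -- The symmetric counterpart of `N`: `y + τ y` and `z + τ z` are multiples `a`, `b` of fixed
    -- points, so `a * b` is at most twice the sum of `coshDist y z` and `coshDist y (τ • z)`.
    -- Adding the formula `hF` cancels `coshDist y z`.
    have h7 : ν y * ν z + lorentz (N y.vec) (N z.vec) ≤ 4 * coshDist y (τ • z) := by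
      obtain ⟨f, a, a0, hf, hfe, ha, -⟩ := exists_fixed_of_involution hτ y
      obtain ⟨g, b, b0, hg, hge, hb, -⟩ := exists_fixed_of_involution hτ z
      have g1 : lorentz (y.vec + (τ • y).vec) (z.vec + (τ • z).vec) = -(a * b * coshDist f g) := by
        rw [hfe, hge, lorentz_smul_left, lorentz_smul_right, lorentz_vec]; ring
      simp only [lorentz_add_left, lorentz_add_right, lorentz_vec, hsym, hττ] at g1
      have ya : ν y ≤ a := by
        apply abs_le_of_sq_le_sq' _ a0.le |>.2
        rw [ν2, hF, coshDist_self, ha]; linarith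
      have zb : ν z ≤ b := by
        apply abs_le_of_sq_le_sq' _ b0.le |>.2
        rw [ν2, hF, coshDist_self, hb]; linarith
      have g2 : ν y * ν z ≤ a * b := by gcongr
      have g3 : a * b ≤ a * b * coshDist f g :=
        le_mul_of_one_le_right (by positivity) (one_le_coshDist f g)
      rw [hF]
      linarith
    have h8 := mul_le_mul_of_nonneg_left h7 (by positivity : 0 ≤ 2 * (ν y * ν z))
    nlinarith
  have hprod : ν y * ν z ≤ 8 * T * (coshDist y m * coshDist z m) := by
    apply (abs_le_of_sq_le_sq' _ (by positivity)).2
    have := mul_le_mul (hup y hy) (hup z hz) (sq_nonneg _) (by positivity)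
    nlinarith
  have c0 := coshDist_pos y (τ • z)
  have h1 : 4 * κ ^ 4 * (coshDist y m * coshDist z m) ^ 2 ≤
      (2 * (8 * T * (coshDist y m * coshDist z m))) * (4 * coshDist y (τ • z)) :=
    hmain.trans (by gcongr)
  have h2 : 0 ≤ (4 * (coshDist y m * coshDist z m)) *
      (16 * T * coshDist y (τ • z) - κ ^ 4 * (coshDist y m * coshDist z m)) := by
    nlinarith
  have h3 := nonneg_of_mul_nonneg_right h2 (by positivity)
  rw [coshDist_comm m z, div_mul_eq_mul_div, le_div_iff₀ (by positivity)]
  have h4 : coshDist y m * coshDist m (τ • m) * coshDist z m ≤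
      T * (coshDist y m * coshDist z m) := by
    have := mul_le_mul_of_nonneg_right hT (mul_pos Y0 Z0).le
    linarith
  calc coshDist y m * coshDist m (τ • m) * coshDist z m * κ ^ 4
      ≤ T * (coshDist y m * coshDist z m) * κ ^ 4 := by gcongr
    _ = T * (κ ^ 4 * (coshDist y m * coshDist z m)) := by ring
    _ ≤ T * (16 * T * coshDist y (τ • z)) := by
      apply mul_le_mul_of_nonneg_left _ (by linarith); linarith
    _ = 16 * T ^ 2 * coshDist y (τ • z) := by ring

end Doors

/-! ### From local to global: broken paths with long segments. -/

section Chains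

variable {n : ℕ} {ι : Type*}

/-- The local-to-global principle for a chain of copies of `L`: `l` is the list of the letters
crossed, `enter C η ξ` and `leave C η ξ` describe the position of the segments before and after
crossing the letter `C`. -/
theorem chain_estimate {L : Set (Hyp n)} {τ : ι → IsomHyp n} {compat : ι → ι → Prop}
    {enter leave : ι → Hyp n → Hyp n → Prop} {K A : ℝ} (hK : 1 ≤ K) (hA : 8 * K ≤ A)
    (hQ : ∀ C, ∀ η ∈ L, ∀ ξ, ∀ η', ∀ ξ' ∈ L, enter C η ξ → leave C η' ξ' →
      coshDist η ξ * coshDist ξ (τ C • η') * coshDist η' ξ' ≤ K * coshDist η (τ C • ξ'))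
    (hleave : ∀ C, ∀ q ∈ L, ∃ η, leave C η q)
    (hconn : ∀ C C', compat C C' → ∃ η ∈ L, ∃ ξ ∈ L, leave C η ξ ∧ enter C' η ξ ∧
      A ≤ coshDist η ξ)
    {q : Hyp n} (hq : q ∈ L) (l : List ι) : ∀ C, (C :: l).IsChain compat →
      ∀ η ∈ L, ∀ ξ, enter C η ξ → ∃ η',
        coshDist η ξ * coshDist ξ (τ C • η') * coshDist η' ((l.map τ).prod • q) ≤
          4 * K * coshDist η (τ C • (l.map τ).prod • q) ∧
        (l ≠ [] → A ≤ 4 * K * coshDist η' ((l.map τ).prod • q)) := by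
  induction l with
  | nil =>
    intro C _ η hη ξ hξ
    obtain ⟨η', h⟩ := hleave C q hq
    refine ⟨η', ?_, fun h => absurd rfl h⟩
    simp only [List.map_nil, List.prod_nil, one_smul]
    have h1 := hQ C η hη ξ η' q hq hξ h
    have h2 := mul_pos (zero_lt_one.trans_le hK) (coshDist_pos η (τ C • q))
    linarith
  | cons C' l ih =>
    intro C hC η hη ξ hξ
    rw [List.isChain_cons_cons] at hC
    obtain ⟨η₁, hη₁, ξ₂, hξ₂, hex, hen, hAc⟩ := hconn C C' hC.1
    obtain ⟨η₂, h1, -⟩ := ih C' hC.2 η₁ hη₁ ξ₂ hen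
    have hloc := hQ C η hη ξ η₁ ξ₂ hξ₂ hξ hex
    simp only [List.map_cons, List.prod_cons, mul_smul]
    set X := τ C' • (l.map τ).prod • q with hX
    have t1 := coshDist_triangle ξ₂ (τ C' • η₂) X
    rw [hX, coshDist_smul, ← hX] at t1
    have t2 := coshDist_triangle η ξ (τ C • η₁)
    -- The two diagonals cross: the local estimate controls `η` to `τ C • ξ₂`, and the long segment
    -- from `η₁` to `ξ₂` makes the term without the wanted distance negligible.
    have h4 := coshDist_four_point (τ C • X) (τ C • ξ₂) (τ C • η₁) η
    rw [coshDist_smul, coshDist_smul, coshDist_smul, coshDist_comm X η₁, coshDist_comm X ξ₂,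
      coshDist_comm (τ C • ξ₂) η, coshDist_comm (τ C • η₁) η, coshDist_comm ξ₂ η₁,
      coshDist_comm (τ C • X) η] at h4
    refine ⟨η₁, ?_, fun _ => ?_⟩
    · set a := coshDist η₁ ξ₂
      set b := coshDist η₁ X
      set P := coshDist η ξ * coshDist ξ (τ C • η₁) with hP
      set d := coshDist ξ₂ X
      set e := coshDist η (τ C • ξ₂)
      set f := coshDist η (τ C • η₁)
      set g := coshDist η (τ C • X)
      set w := coshDist ξ₂ (τ C' • η₂) * coshDist η₂ ((l.map τ).prod • q) with hw
      have a0 : 0 < a := coshDist_pos _ _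
      have b0 : 0 < b := coshDist_pos _ _
      have d0 : 0 < d := coshDist_pos _ _
      have P0 : 0 < P := mul_pos (coshDist_pos _ _) (coshDist_pos _ _)
      have K0 : 0 < K := by linarith
      have q1 : a * w ≤ 4 * K * b := by rw [hw]; linarith
      have q2 : d ≤ 2 * w := by rw [hw]; linarith
      have q3 : f ≤ 2 * P := by rw [hP]; linarith
      have q4 : a * d ≤ 8 * K * b := by nlinarith
      have q5 : d * f ≤ d * (2 * P) := mul_le_mul_of_nonneg_left q3 d0.le
      have q6 : P * a * b ≤ K * (2 * (d * (2 * P) + a * g)) := by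
        have := mul_le_mul_of_nonneg_right hloc b0.le
        have h5 : b * e ≤ 2 * (d * (2 * P) + a * g) := by linarith
        have := mul_le_mul_of_nonneg_left h5 K0.le
        linarith
      -- With `a ≥ 8 * K` the error term is at most half of the left side. Absorbing it turns `2 *
      -- K` into `4 * K`, so the constant does not deteriorate along the induction.
      have q7 : 8 * K ≤ a := hA.trans hAc
      have q8 : 32 * K ^ 2 * (P * b) ≤ a * a / 2 * (P * b) := by
        apply mul_le_mul_of_nonneg_right _ (by positivity)
        nlinarith
      have q9 : a * (P * a * b) ≤ a * (K * (2 * (d * (2 * P) + a * g))) :=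
        mul_le_mul_of_nonneg_left q6 a0.le
      have q10 : 4 * K * P * (a * d) ≤ 4 * K * P * (8 * K * b) :=
        mul_le_mul_of_nonneg_left q4 (by positivity)
      have q11 : 0 ≤ a * a * (4 * K * g - P * b) := by nlinarith
      have := nonneg_of_mul_nonneg_right q11 (by positivity)
      linarith
    · have g1 := one_le_coshDist ξ₂ (τ C' • η₂)
      have g2 := one_le_coshDist η₂ ((l.map τ).prod • q)
      have g3 := mul_le_mul g1 g2 zero_le_one (by linarith)
      have g4 := mul_le_mul_of_nonneg_left g3 (coshDist_pos η₁ ξ₂).le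
      linarith

/-- Comparing the long segment with the tail, and the tail with the whole path, costs a factor `4 *
K` each time; `A ≥ 32 * K ^ 2` leaves 2. -/
theorem two_le_coshDist_of_chain {L : Set (Hyp n)} {τ : ι → IsomHyp n}
    {compat : ι → ι → Prop} {enter leave : ι → Hyp n → Hyp n → Prop} {K A : ℝ} (hK : 1 ≤ K)
    (hA : 32 * K ^ 2 ≤ A)
    (hQ : ∀ C, ∀ η ∈ L, ∀ ξ, ∀ η', ∀ ξ' ∈ L, enter C η ξ → leave C η' ξ' →
      coshDist η ξ * coshDist ξ (τ C • η') * coshDist η' ξ' ≤ K * coshDist η (τ C • ξ'))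
    (henter : ∀ C, ∀ p ∈ L, ∃ ξ, enter C p ξ) (hleave : ∀ C, ∀ q ∈ L, ∃ η, leave C η q)
    (hconn : ∀ C C', compat C C' → ∃ η ∈ L, ∃ ξ ∈ L, leave C η ξ ∧ enter C' η ξ ∧
      A ≤ coshDist η ξ)
    {p q : Hyp n} (hp : p ∈ L) (hq : q ∈ L) {l : List ι} (hl : l.IsChain compat)
    (h2 : 2 ≤ l.length) : 2 ≤ coshDist p ((l.map τ).prod • q) := by
  match l, hl, h2 with
  | C :: C' :: l, hl, _ =>
    obtain ⟨ξ, hξ⟩ := henter C p hp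
    obtain ⟨η, h1, h3⟩ := chain_estimate hK (by nlinarith) hQ hleave hconn hq (C' :: l) C hl p hp
      ξ hξ
    have h4 := h3 (List.cons_ne_nil _ _)
    rw [List.map_cons, List.prod_cons, mul_smul]
    set X := ((C' :: l).map τ).prod • q
    have g1 := mul_le_mul (one_le_coshDist p ξ) (one_le_coshDist ξ (τ C • η)) zero_le_one
      (coshDist_pos _ _).le
    have g2 := mul_le_mul_of_nonneg_right g1 (coshDist_pos η X).le
    have g3 : 4 * K * coshDist η X ≤ 4 * K * (4 * K * coshDist p (τ C • X)) := by
      apply mul_le_mul_of_nonneg_left _ (by linarith)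
      linarith
    have g4 : 0 ≤ 16 * K ^ 2 * (coshDist p (τ C • X) - 2) := by nlinarith
    have := nonneg_of_mul_nonneg_right g4 (by positivity)
    linarith

end Chains

/-! ### Relations and generators of the fundamental group. -/

namespace QuadrilateralOfGroups

theorem of_toFst (Q : QuadrilateralOfGroups) (i : Fin 4) (h : Q.edge i) :
    Q.of i (Q.toFst i h) = Q.of (i + 1) (Q.toSnd i h) := by
  rw [← mul_inv_eq_one, ← map_inv]
  apply (QuotientGroup.eq_one_iff _).2
  apply Subgroup.subset_normalClosure
  exact ⟨i, h, by rw [map_inv]⟩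

theorem induction_of (Q : QuadrilateralOfGroups) {p : Q.FundamentalGroup → Prop} (one : p 1)
    (of : ∀ i g, p (Q.of i g)) (mul : ∀ x y, p x → p y → p (x * y)) (x : Q.FundamentalGroup) :
    p x := by
  obtain ⟨x, rfl⟩ := QuotientGroup.mk'_surjective (Subgroup.normalClosure Q.relations) x
  induction x using Monoid.CoprodI.induction_on with
  | one => exact one
  | of i g => exact of i g
  | mul x y hx hy => exact mul _ _ hx hy

end QuadrilateralOfGroups

/-! ### Words in the crossings and their reduction. -/

namespace QuadrilateralData

variable (D : QuadrilateralData)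

/-- A letter `(some i, g)` stands for the conjugate by `g` of the involution with index `i`, a
letter `(none, g)` for the conjugate by `g` of the product of the two involutions. -/
abbrev Letter : Type := Option (Fin 2) × D.G

variable {D}

/-- The geodesics that belong to a letter. -/
def doors (C : D.Letter) : Set (Set (Hyp 5)) :=
  {β | ∃ i, (C.1 = none ∨ C.1 = some i) ∧ β = (C.2 : IsomHyp 5) • D.γ i}

/-- The condition on consecutive letters in a reduced word. -/
def Compat (R : ℝ) (C C' : D.Letter) : Prop :=
  Disjoint (doors C) (doors C') ∧ ∀ i j, C.1 = some i → C'.1 = some j →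
    R ≤ setDist ((C.2 : IsomHyp 5) • D.γ i) ((C'.2 : IsomHyp 5) • D.γ j)

/-- Since `A i` is the full stabilizer of `γ i`, an element carrying `γ i` to `γ j` conjugates `A i`
to `A j`; non-conjugacy forces `i = j`. Hence a geodesic of the orbit determines its index and its
coset. -/
theorem smul_γ_eq {i j : Fin 2} {g h : D.G}
    (e : (g : IsomHyp 5) • D.γ i = (h : IsomHyp 5) • D.γ j) : i = j ∧ h⁻¹ * g ∈ D.A i := by
  have e' : ((h⁻¹ * g : D.G) : IsomHyp 5) • D.γ i = D.γ j := by
    rw [Subgroup.coe_mul, mul_smul, e, Subgroup.coe_inv, inv_smul_smul]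
  have hconj : ∀ {i j : Fin 2} {k : D.G}, (k : IsomHyp 5) • D.γ i = D.γ j →
      (D.A i).map (MulAut.conj k).toMonoidHom = D.A j := by
    intro i j k hk
    have hk' : ((k⁻¹ : D.G) : IsomHyp 5) • D.γ j = D.γ i := by
      rw [← hk, Subgroup.coe_inv, inv_smul_smul]
    ext a
    constructor
    · rintro ⟨b, hb, rfl⟩
      apply D.mem_A_of_smul_γ
      show ((k * b * k⁻¹ : D.G) : IsomHyp 5) • D.γ j = D.γ j
      rw [Subgroup.coe_mul, Subgroup.coe_mul, mul_smul, mul_smul, hk', D.smul_γ i b hb, hk]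
    · intro ha
      refine ⟨k⁻¹ * a * k, ?_, ?_⟩
      · apply D.mem_A_of_smul_γ
        rw [Subgroup.coe_mul, Subgroup.coe_mul, mul_smul, mul_smul, hk, D.smul_γ j a ha, hk']
      · show k * (k⁻¹ * a * k) * k⁻¹ = a
        group
  have hij : i = j := by
    by_contra hne
    have : (i = 0 ∧ j = 1) ∨ (i = 1 ∧ j = 0) := by omega
    rcases this with ⟨rfl, rfl⟩ | ⟨rfl, rfl⟩
    · exact D.not_conj_A _ (hconj e')
    · refine D.not_conj_A (h⁻¹ * g)⁻¹ (hconj ?_)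
      rw [← e', Subgroup.coe_inv, inv_smul_smul]
  subst hij
  exact ⟨rfl, D.mem_A_of_smul_γ i _ e'⟩

section Words

variable {H : Type*} [Group H] (ρ : D.G →* H) (s : Fin 2 → H)

/-- The element of `H` that a letter stands for. -/
def letter (C : D.Letter) : H :=
  ρ C.2 * (match C.1 with
    | none => s 0 * s 1
    | some i => s i) * (ρ C.2)⁻¹

/-- The weight of a letter in the length of words. -/
def weight (C : D.Letter) : ℕ := if C.1 = none then 3 else 2

/-- The total weight of a word. -/
def cost (l : List D.Letter) : ℕ := (l.map weight).sum

theorem cost_append (l l' : List D.Letter) : cost (l ++ l') = cost l + cost l' := by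
  simp [cost]

theorem cost_cons (C : D.Letter) (l : List D.Letter) : cost (C :: l) = weight C + cost l := by
  simp [cost]

variable {ρ s}

theorem letter_some_eq (hA : ∀ i, ∀ a ∈ D.A i, s i * ρ a = ρ a * s i) {i : Fin 2} {g h : D.G}
    (e : h⁻¹ * g ∈ D.A i) : letter ρ s (some i, g) = letter ρ s (some i, h) := by
  have hg : g = h * (h⁻¹ * g) := by group
  generalize h⁻¹ * g = a at *
  subst hg
  simp only [letter, map_mul, mul_inv_rev]
  have := hA i a e
  calc ρ h * ρ a * s i * ((ρ a)⁻¹ * (ρ h)⁻¹) = ρ h * (ρ a * s i) * (ρ a)⁻¹ * (ρ h)⁻¹ := by group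
    _ = ρ h * s i * (ρ h)⁻¹ := by rw [← this]; group

theorem letter_some_mul_self (hs : ∀ i, s i * s i = 1) (i : Fin 2) (g : D.G) :
    letter ρ s (some i, g) * letter ρ s (some i, g) = 1 := by
  simp only [letter]
  calc ρ g * s i * (ρ g)⁻¹ * (ρ g * s i * (ρ g)⁻¹) = ρ g * (s i * s i) * (ρ g)⁻¹ := by group
    _ = 1 := by rw [hs]; group

theorem letter_none (hcomm : s 0 * s 1 = s 1 * s 0) {i j : Fin 2} (hij : i ≠ j) (g : D.G) :
    letter ρ s (none, g) = letter ρ s (some i, g) * letter ρ s (some j, g) := by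
  have h : s 0 * s 1 = s i * s j := by
    have : (i = 0 ∧ j = 1) ∨ (i = 1 ∧ j = 0) := by omega
    rcases this with ⟨rfl, rfl⟩ | ⟨rfl, rfl⟩
    · rfl
    · exact hcomm
  simp only [letter, h]
  group

/-- Either involution can be split off from a double letter, on either side. What remains weighs
strictly less than the letter, so cancelling a common geodesic always lowers the cost. -/
theorem exists_mul_letter (hcomm : s 0 * s 1 = s 1 * s 0)
    {C : D.Letter} {i : Fin 2} (hi : C.1 = none ∨ C.1 = some i) :
    ∃ l : List D.Letter, cost l < weight C ∧
      (l.map (letter ρ s)).prod * letter ρ s (some i, C.2) = letter ρ s C ∧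
      letter ρ s (some i, C.2) * (l.map (letter ρ s)).prod = letter ρ s C := by
  obtain ⟨o, g⟩ := C
  rcases hi with rfl | rfl
  · obtain ⟨j, hj⟩ : ∃ j : Fin 2, i ≠ j := ⟨1 - i, by omega⟩
    refine ⟨[(some j, g)], by simp [cost, weight], ?_, ?_⟩
    · simp only [List.map_cons, List.map_nil, List.prod_singleton]
      exact (letter_none hcomm hj.symm g).symm
    · simp only [List.map_cons, List.map_nil, List.prod_singleton]
      exact (letter_none hcomm hj g).symm
  · exact ⟨[], by simp [cost, weight], by simp, by simp⟩

/-- Two geodesics of the orbit that are close to each other are carried to `γ 0` and `γ 1`. -/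
theorem Separated.exists_smul_eq {R₀ R R₁ : ℝ} (hD : D.Separated R₀ R R₁) {i j : Fin 2}
    {g h : D.G} (hne : (g : IsomHyp 5) • D.γ i ≠ (h : IsomHyp 5) • D.γ j)
    (hR : ¬R ≤ setDist ((g : IsomHyp 5) • D.γ i) ((h : IsomHyp 5) • D.γ j)) :
    ∃ (k : D.G) (a b : Fin 2), a ≠ b ∧
      (g : IsomHyp 5) • D.γ i = (k : IsomHyp 5) • D.γ a ∧
      (h : IsomHyp 5) • D.γ j = (k : IsomHyp 5) • D.γ b := by
  obtain ⟨k, hk, e⟩ := (hD.dist_orbit _ ⟨g, g.2, i, rfl⟩ _ ⟨h, h.2, j, rfl⟩ hne).resolve_left hR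
  have key : ∀ (g : D.G) (i : Fin 2), k • (g : IsomHyp 5) • D.γ i ⊆ D.γ 0 ∪ D.γ 1 →
      ∃ a, (g : IsomHyp 5) • D.γ i = k⁻¹ • D.γ a := by
    intro g i hsub
    rcases (((D.isHypSubspace_γ i).smul _).smul _).eq_or_eq_of_subset_union
      (D.isHypSubspace_γ 0) (D.isHypSubspace_γ 1) hsub with h | h
    · exact ⟨0, by rw [← h, inv_smul_smul]⟩
    · exact ⟨1, by rw [← h, inv_smul_smul]⟩
  rw [Set.smul_set_union] at e
  obtain ⟨a, ha⟩ := key g i (e ▸ Set.subset_union_left)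
  obtain ⟨b, hb⟩ := key h j (e ▸ Set.subset_union_right)
  refine ⟨(⟨k, hk⟩ : D.G)⁻¹, a, b, ?_, ha, hb⟩
  rintro rfl
  exact hne (ha.trans hb.symm)

/-- Words with incompatible consecutive letters can be shortened. -/
theorem exists_cost_lt (hs : ∀ i, s i * s i = 1) (hcomm : s 0 * s 1 = s 1 * s 0)
    (hA : ∀ i, ∀ a ∈ D.A i, s i * ρ a = ρ a * s i) {R₀ R R₁ : ℝ} (hD : D.Separated R₀ R R₁)
    {C C' : D.Letter} (hC : ¬Compat R C C') :
    ∃ l : List D.Letter, cost l < weight C + weight C' ∧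
      (l.map (letter ρ s)).prod = letter ρ s C * letter ρ s C' := by
  by_cases hdis : Disjoint (doors C) (doors C')
  · have : ∃ i j, C.1 = some i ∧ C'.1 = some j ∧
        ¬R ≤ setDist ((C.2 : IsomHyp 5) • D.γ i) ((C'.2 : IsomHyp 5) • D.γ j) := by
      by_contra! h
      exact hC ⟨hdis, fun i j hi hj => h i j hi hj⟩
    obtain ⟨i, j, hi, hj, hR⟩ := this
    obtain ⟨o, g⟩ := C
    obtain ⟨o', h⟩ := C'
    obtain rfl : o = some i := hi
    obtain rfl : o' = some j := hj
    have hne : (g : IsomHyp 5) • D.γ i ≠ (h : IsomHyp 5) • D.γ j := fun e =>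
      Set.disjoint_left.1 hdis ⟨i, .inr rfl, rfl⟩ ⟨j, .inr rfl, e⟩
    obtain ⟨k, a, b, hab, ha, hb⟩ := hD.exists_smul_eq hne hR
    -- Merging two single letters into a double one lowers the cost because `3 < 2 + 2`; this is why
    -- the weights are not 1 and 2.
    refine ⟨[(none, k)], by simp [cost, weight], ?_⟩
    obtain ⟨rfl, ha'⟩ := smul_γ_eq ha
    obtain ⟨rfl, hb'⟩ := smul_γ_eq hb
    rw [List.map_singleton, List.prod_singleton, letter_none hcomm hab, letter_some_eq hA ha',
      letter_some_eq hA hb']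
  · rw [Set.not_disjoint_iff] at hdis
    obtain ⟨_, ⟨i, hi, rfl⟩, ⟨j, hj, e⟩⟩ := hdis
    obtain ⟨rfl, e'⟩ := smul_γ_eq e
    obtain ⟨l, hl, hl', -⟩ := exists_mul_letter (ρ := ρ) hcomm hi
    obtain ⟨l', hl₁, -, hl₂⟩ := exists_mul_letter (ρ := ρ) hcomm hj
    refine ⟨l ++ l', by rw [cost_append]; omega, ?_⟩
    rw [List.map_append, List.prod_append, ← hl', ← hl₂, letter_some_eq hA e']
    set t := letter ρ s (some i, C'.2)
    have ht : t * t = 1 := letter_some_mul_self hs _ _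
    calc (l.map (letter ρ s)).prod * (l'.map (letter ρ s)).prod
        = (l.map (letter ρ s)).prod * (t * t) * (l'.map (letter ρ s)).prod := by
          rw [ht, mul_one]
      _ = _ := by group

theorem exists_append_of_not_isChain {β : Type*} {r : β → β → Prop} :
    ∀ {l : List β}, ¬l.IsChain r → ∃ l₁ a b l₂, l = l₁ ++ a :: b :: l₂ ∧ ¬r a b
  | [], h => absurd List.IsChain.nil h
  | [a], h => absurd (List.IsChain.singleton a) h
  | a :: b :: l, h => by
    by_cases hab : r a b
    · obtain ⟨l₁, c, d, l₂, e, hcd⟩ := exists_append_of_not_isChain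
        (l := b :: l) (fun h' => h (List.isChain_cons_cons.2 ⟨hab, h'⟩))
      exact ⟨a :: l₁, c, d, l₂, by rw [e, List.cons_append], hcd⟩
    · exact ⟨[], a, b, l, rfl, hab⟩

theorem exists_isChain (hs : ∀ i, s i * s i = 1) (hcomm : s 0 * s 1 = s 1 * s 0)
    (hA : ∀ i, ∀ a ∈ D.A i, s i * ρ a = ρ a * s i) {R₀ R R₁ : ℝ} (hD : D.Separated R₀ R R₁)
    (l : List D.Letter) : ∃ l' : List D.Letter, l'.IsChain (Compat R) ∧
      (l'.map (letter ρ s)).prod = (l.map (letter ρ s)).prod := by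
  induction hn : cost l using Nat.strong_induction_on generalizing l with
  | _ n ih =>
    by_cases hl : l.IsChain (Compat R)
    · exact ⟨l, hl, rfl⟩
    obtain ⟨l₁, C, C', l₂, rfl, hC⟩ := exists_append_of_not_isChain hl
    obtain ⟨l₃, h1, h2⟩ := exists_cost_lt (ρ := ρ) hs hcomm hA hD hC
    obtain ⟨l', h3, h4⟩ := ih (cost (l₁ ++ (l₃ ++ l₂)))
      (by simp only [← hn, cost_append, cost_cons]; omega) _ rfl
    refine ⟨l', h3, ?_⟩
    rw [h4]
    simp only [List.map_append, List.prod_append, List.map_cons, List.prod_cons, h2, mul_assoc]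

/-- Elements of `G` are pushed to the right: `ρ g * s i` is the letter `(some i, g)` times `ρ g`. -/
theorem exists_word (hs : ∀ i, s i * s i = 1) {h : H}
    (hh : h ∈ Subgroup.closure (Set.range ρ ∪ Set.range s)) :
    ∃ (l : List D.Letter) (g : D.G), h = (l.map (letter ρ s)).prod * ρ g := by
  have hmul : ∀ x y, y ∈ Set.range ρ ∪ Set.range s →
      (∃ (l : List D.Letter) (g : D.G), x = (l.map (letter ρ s)).prod * ρ g) →
      ∃ (l : List D.Letter) (g : D.G), x * y = (l.map (letter ρ s)).prod * ρ g := by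
    rintro _ _ (⟨k, rfl⟩ | ⟨i, rfl⟩) ⟨l, g, rfl⟩
    · exact ⟨l, g * k, by rw [map_mul, mul_assoc]⟩
    · refine ⟨l ++ [(some i, g)], g, ?_⟩
      simp only [List.map_append, List.prod_append, List.map_cons, List.map_nil,
        List.prod_singleton, letter]
      group
  induction hh using Subgroup.closure_induction_right with
  | one => exact ⟨[], 1, by simp⟩
  | mul_right x hx y hy ih => exact hmul x y hy ih
  | mul_inv_cancel x hx y hy ih =>
    refine hmul x y⁻¹ ?_ ih
    rcases hy with ⟨k, rfl⟩ | ⟨i, rfl⟩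
    · exact .inl ⟨k⁻¹, map_inv _ _⟩
    · exact .inr ⟨i, eq_inv_of_mul_eq_one_left (hs i)⟩

end Words

/-! ### The fundamental group extended by the symmetries of the square. -/

section Developing

variable (D)

/-- The fundamental group of the quadrilateral of groups. -/
abbrev Fund : Type := D.quadrilateral.FundamentalGroup

/-- The canonical homomorphism of a vertex group to the fundamental group. -/
def vertexHom (k : Fin 4) : D.G →* D.Fund := D.quadrilateral.of k

/-- The reflections of the square. -/
def reflect (i : Fin 2) (k : Fin 4) : Fin 4 := ![![3, 2, 1, 0], ![1, 0, 3, 2]] i k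

theorem reflect_reflect (i : Fin 2) (k : Fin 4) : reflect i (reflect i k) = k := by
  revert i k; decide

theorem reflect_comm (k : Fin 4) : reflect 0 (reflect 1 k) = reflect 1 (reflect 0 k) := by
  revert k; decide

theorem reflect_zero_ne (i : Fin 2) : reflect i 0 ≠ 0 := by
  revert i; decide

theorem vertexHom_reflect (i : Fin 2) (a : D.G) (ha : a ∈ D.A i) (k : Fin 4) :
    D.vertexHom (reflect i k) a = D.vertexHom k a := by
  have h0 : ∀ a ∈ D.A 1, D.vertexHom 0 a = D.vertexHom 1 a := fun a ha =>
    D.quadrilateral.of_toFst 0 ⟨a, ha⟩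
  have h1 : ∀ a ∈ D.A 0, D.vertexHom 1 a = D.vertexHom 2 a := fun a ha =>
    D.quadrilateral.of_toFst 1 ⟨a, ha⟩
  have h2 : ∀ a ∈ D.A 1, D.vertexHom 2 a = D.vertexHom 3 a := fun a ha =>
    D.quadrilateral.of_toFst 2 ⟨a, ha⟩
  have h3 : ∀ a ∈ D.A 0, D.vertexHom 3 a = D.vertexHom 0 a := fun a ha =>
    D.quadrilateral.of_toFst 3 ⟨a, ha⟩
  fin_cases i <;> fin_cases k
  · exact h3 a ha
  · exact (h1 a ha).symm
  · exact h1 a ha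
  · exact (h3 a ha).symm
  · exact (h0 a ha).symm
  · exact h0 a ha
  · exact (h2 a ha).symm
  · exact h2 a ha

/-- Right translation by an element of the vertex group, on pairs of an element of the
fundamental group and a corner of the square. -/
def translate (g : D.G) : Equiv.Perm (D.Fund × Fin 4) where
  toFun x := (x.1 * D.vertexHom x.2 g, x.2)
  invFun x := (x.1 * D.vertexHom x.2 g⁻¹, x.2)
  left_inv x := by simp
  right_inv x := by simp

/-- The reflections of the square, on pairs of an element of the fundamental group and a corner
of the square. -/
def flip (i : Fin 2) : Equiv.Perm (D.Fund × Fin 4) where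
  toFun x := (x.1, reflect i x.2)
  invFun x := (x.1, reflect i x.2)
  left_inv x := by simp [reflect_reflect]
  right_inv x := by simp [reflect_reflect]

/-- The group of transformations in which words are evaluated. -/
abbrev Dev : Type := (Equiv.Perm (D.Fund × Fin 4))ᵐᵒᵖ × IsomHyp 5

/-- The vertex group in `Dev`. -/
def devHom : D.G →* D.Dev where
  toFun g := (MulOpposite.op (D.translate g), g)
  map_one' := by
    refine Prod.ext (congrArg MulOpposite.op (Equiv.ext fun x => ?_)) rfl
    simp [translate]
  map_mul' g h := by
    refine Prod.ext (congrArg MulOpposite.op (Equiv.ext fun x => ?_)) rfl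
    simp [translate, mul_assoc]

/-- The involutions in `Dev`. -/
def devFlip (i : Fin 2) : D.Dev := (MulOpposite.op (D.flip i), D.σ i)

theorem devFlip_mul_self (i : Fin 2) : D.devFlip i * D.devFlip i = 1 := by
  refine Prod.ext (congrArg MulOpposite.op (Equiv.ext fun x => ?_)) (D.σ_mul_self i)
  exact Prod.ext rfl (reflect_reflect i x.2)

theorem devFlip_comm : D.devFlip 0 * D.devFlip 1 = D.devFlip 1 * D.devFlip 0 := by
  refine Prod.ext (congrArg MulOpposite.op (Equiv.ext fun x => ?_)) D.σ_comm
  exact Prod.ext rfl (reflect_comm x.2).symm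

theorem devFlip_mul_devHom (i : Fin 2) (a : D.G) (ha : a ∈ D.A i) :
    D.devFlip i * D.devHom a = D.devHom a * D.devFlip i := by
  refine Prod.ext (congrArg MulOpposite.op (Equiv.ext fun x => ?_)) ?_
  · refine Prod.ext ?_ rfl
    show x.1 * D.vertexHom (reflect i x.2) a = x.1 * D.vertexHom x.2 a
    rw [D.vertexHom_reflect i a ha]
  · exact mul_inv_eq_iff_eq_mul.1 (D.σ_conj i a ha)

/-- The elements of `Dev` that carry the first corner to the other ones. -/
def devCorner : Fin 4 → D.Dev :=
  ![1, D.devFlip 1, D.devFlip 0 * D.devFlip 1, D.devFlip 0]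

theorem devCorner_apply (k : Fin 4) (y : D.Fund) :
    (D.devCorner k).1.unop (y, 0) = (y, k) := by
  fin_cases k <;> rfl

theorem devCorner_snd (k : Fin 4) : (D.devCorner k).2 = D.corner k := by
  fin_cases k <;> rfl

theorem devCorner_mem (k : Fin 4) :
    D.devCorner k ∈ Subgroup.closure (Set.range D.devHom ∪ Set.range D.devFlip) := by
  have h : ∀ i, D.devFlip i ∈ Subgroup.closure (Set.range D.devHom ∪ Set.range D.devFlip) :=
    fun i => Subgroup.subset_closure (.inr ⟨i, rfl⟩)
  fin_cases k
  · exact one_mem _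
  · exact h 1
  · exact mul_mem (h 0) (h 1)
  · exact h 0

/-- `Dev` stands in for the semidirect product of the fundamental group with the reflections of the
square. Pairing it with the isometry group lets one reduction of words act on both at once: the
first factor recovers `x`, the second its image under `rep`. The opposite group appears because
right translations compose in reverse. -/
theorem exists_dev (x : D.Fund) :
    ∃ h ∈ Subgroup.closure (Set.range D.devHom ∪ Set.range D.devFlip),
      (∀ y, h.1.unop (y, 0) = (y * x, 0)) ∧ h.2 = D.rep x := by
  induction x using D.quadrilateral.induction_of with
  | one => exact ⟨1, one_mem _, fun y => by simp, by rw [map_one]; rfl⟩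
  | of k g =>
    refine ⟨D.devCorner k * D.devHom g * (D.devCorner k)⁻¹,
      mul_mem (mul_mem (D.devCorner_mem k) (Subgroup.subset_closure (.inl ⟨g, rfl⟩)))
        (inv_mem (D.devCorner_mem k)), fun y => ?_, ?_⟩
    · show (D.devCorner k).1.unop⁻¹ (D.translate g ((D.devCorner k).1.unop (y, 0))) = _
      rw [D.devCorner_apply, Equiv.Perm.inv_eq_iff_eq, D.devCorner_apply]
      rfl
    · refine Eq.trans ?_ (D.quadrilateral.lift_of D.vertexRep D.vertexRep_compatible k g).symm
      show (D.devCorner k).2 * D.G.subtype g * (D.devCorner k).2⁻¹ = _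
      rw [D.devCorner_snd]
      rfl
  | mul x y hx hy =>
    obtain ⟨h, hh, h1, h2⟩ := hx
    obtain ⟨k, hk, k1, k2⟩ := hy
    refine ⟨h * k, mul_mem hh hk, fun z => ?_, ?_⟩
    · show k.1.unop (h.1.unop (z, 0)) = _
      rw [h1, k1, mul_assoc]
    · rw [map_mul, Prod.snd_mul, h2, k2]

/-- Elements of the fundamental group outside of the first vertex group are represented by
reduced words of length at least two. -/
theorem exists_reduced_word {R₀ R R₁ : ℝ} (hD : D.Separated R₀ R R₁) (x : D.Fund) :
    (∃ g, x = D.vertexHom 0 g) ∨ ∃ l : List D.Letter, l.IsChain (Compat R) ∧ 2 ≤ l.length ∧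
      ∃ g : D.G, D.rep x = (l.map (letter D.G.subtype D.σ)).prod * g := by
  obtain ⟨h, hh, h1, h2⟩ := D.exists_dev x
  obtain ⟨l₀, g, rfl⟩ := exists_word D.devFlip_mul_self hh
  obtain ⟨l, hl, e⟩ := exists_isChain (ρ := D.devHom) D.devFlip_mul_self D.devFlip_comm
    D.devFlip_mul_devHom hD l₀
  rw [← e] at h1 h2
  have h3 := h1 1
  rw [one_mul] at h3
  match l, hl, h2, h3 with
  | [], _, _, h3 =>
    left
    refine ⟨g, ?_⟩
    have : ((1 : D.Fund) * D.vertexHom 0 g, (0 : Fin 4)) = (x, 0) := h3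
    rw [one_mul] at this
    exact (congrArg Prod.fst this).symm
  -- A single letter moves corner 0 to another corner, whereas `x` keeps it.
  | [(o, k)], _, _, h3 =>
    exfalso
    have h4 := congrArg Prod.snd h3
    rw [List.map_singleton, List.prod_singleton] at h4
    match o, h4 with
    | none, h4 =>
      have : reflect 1 (reflect 0 0) = 0 := h4
      revert this; decide
    | some i, h4 =>
      exact reflect_zero_ne i h4
  | C :: C' :: l, hl, h2, _ =>
    right
    refine ⟨C :: C' :: l, hl, by simp, g, ?_⟩
    rw [← h2, Prod.snd_mul]
    congr 1
    rw [← MonoidHom.coe_snd, map_list_prod, List.map_map]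
    congr 1
    apply List.map_congr_left
    rintro ⟨o, k⟩ -
    cases o <;> rfl

end Developing

end QuadrilateralData

/-! ### The broken path of a reduced word, and discreteness. -/

namespace QuadrilateralData

variable (D : QuadrilateralData)

theorem σ_smul_of_mem {i : Fin 2} {x : Hyp 5} (hx : x ∈ D.S i) : D.σ i • x = x := by
  rw [← D.fixed_σ] at hx
  exact hx

theorem σ_smul_γ {i : Fin 2} {x : Hyp 5} (hx : x ∈ D.γ i) : D.σ i • x = x := by
  rw [← D.S_inter_L] at hx
  exact D.σ_smul_of_mem hx.1

theorem σ_smul_σ_smul (i : Fin 2) (x : Hyp 5) : D.σ i • D.σ i • x = x := by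
  rw [smul_smul, D.σ_mul_self, one_smul]

theorem smul_mem_L {x : Hyp 5} (g : D.G) (hx : x ∈ D.L) : (g : IsomHyp 5) • x ∈ D.L := by
  rw [← D.smul_L g g.2]
  exact Set.smul_mem_smul_set hx

theorem inv_smul_mem_L {x : Hyp 5} (g : D.G) (hx : x ∈ D.L) :
    (g : IsomHyp 5)⁻¹ • x ∈ D.L := by
  rw [← Subgroup.coe_inv]
  exact D.smul_mem_L g⁻¹ hx

theorem smul_γ_subset_L (g : D.G) (i : Fin 2) : (g : IsomHyp 5) • D.γ i ⊆ D.L := by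
  rintro _ ⟨x, hx, rfl⟩
  exact D.smul_mem_L g (D.γ_subset_L i hx)

theorem mul_σ_mul_self : (D.σ 0 * D.σ 1) * (D.σ 0 * D.σ 1) = 1 := by
  calc (D.σ 0 * D.σ 1) * (D.σ 0 * D.σ 1) = D.σ 0 * (D.σ 1 * D.σ 0) * D.σ 1 := by group
    _ = (D.σ 0 * D.σ 0) * (D.σ 1 * D.σ 1) := by rw [← D.σ_comm]; group
    _ = 1 := by rw [D.σ_mul_self, D.σ_mul_self, one_mul]

/-- Every vector is a sum of vectors fixed by the two involutions. -/
theorem exists_add_fixed (v : Fin (5 + 1) → ℝ) : ∃ a b : Fin (5 + 1) → ℝ, v = a + b ∧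
    (D.σ 0).1.1.mulVec a = a ∧ (D.σ 1).1.1.mulVec b = b := by
  obtain ⟨hne, W, hW, hSW⟩ := D.isHypSubspace_S_inter_S
  choose V hV hSV using fun i => (D.isHypSubspace_S i).2
  have hinf : D.S 0 ∩ D.S 1 = {x | x.vec ∈ V 0 ⊓ V 1} := by
    rw [hSV 0, hSV 1]; rfl
  have e : V 0 ⊓ V 1 = W := by
    apply le_antisymm
    · exact vec_mem_of_forall hne hinf fun x hx => by rw [hSW] at hx; exact hx
    · exact vec_mem_of_forall hne hSW fun x hx => by rw [hinf] at hx; exact hx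
  have hfix : ∀ i, ∀ v ∈ V i, (D.σ i).1.1.mulVec v = v := by
    intro i v hv
    have : V i ≤ LinearMap.ker (Matrix.mulVecLin (D.σ i).1.1 - LinearMap.id) := by
      refine vec_mem_of_forall (D.isHypSubspace_S i).1 (hSV i) fun x hx => ?_
      rw [LinearMap.mem_ker, LinearMap.sub_apply, sub_eq_zero]
      exact congrArg Hyp.vec (D.σ_smul_of_mem hx)
    have h := this hv
    rw [LinearMap.mem_ker, LinearMap.sub_apply, sub_eq_zero] at h
    exact h
  have htop : V 0 ⊔ V 1 = ⊤ := by
    -- The dimensions are 4 + 4 - 2 = 6.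
    apply Submodule.eq_top_of_finrank_eq
    have := Submodule.finrank_sup_add_finrank_inf_eq (V 0) (V 1)
    rw [e, hW, hV, hV] at this
    rw [Module.finrank_fin_fun]
    omega
  obtain ⟨a, ha, b, hb, hab⟩ := Submodule.mem_sup.1 (htop ▸ Submodule.mem_top : v ∈ V 0 ⊔ V 1)
  exact ⟨a, b, hab.symm, hfix 0 a ha, hfix 1 b hb⟩

/-- The product of the involutions has no fixed points outside of `S 0 ∩ S 1`. -/
theorem mem_S_inter_S_of_fixed {f : Hyp 5} (hf : (D.σ 0 * D.σ 1) • f = f) :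
    f ∈ D.S 0 ∩ D.S 1 := by
  have e01 : D.σ 1 • f = D.σ 0 • f := by
    rw [mul_smul] at hf
    rw [← hf, D.σ_smul_σ_smul, hf]
  obtain ⟨a, b, hab, ha, hb⟩ := D.exists_add_fixed f.vec
  set P := (D.σ 0).1.1 with hP
  set Q := (D.σ 1).1.1 with hQ
  have hPQ : P * Q = Q * P :=
    congrArg (fun g : IsomHyp 5 => g.1.1) D.σ_comm
  have h0 : (D.σ 0 • f).vec = a + P.mulVec b := by
    rw [vec_smul, hab, Matrix.mulVec_add, ha]
  have h1 : (D.σ 0 • f).vec = Q.mulVec a + b := by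
    rw [← e01, vec_smul, hab, Matrix.mulVec_add, hb]
  have h2 : f.vec = Q.mulVec a + P.mulVec b := by
    rw [← D.σ_smul_σ_smul 1 f, vec_smul, e01, h0, Matrix.mulVec_add, Matrix.mulVec_mulVec,
      ← hPQ, ← Matrix.mulVec_mulVec, hb]
  have h3 : D.σ 0 • f = f := by
    apply Hyp.vec_injective
    -- The two expressions for `σ 0 • f` add up to `a + b` plus `Q a + P b`, and both of these are
    -- `f`.
    have h4 : (D.σ 0 • f).vec + (D.σ 0 • f).vec = f.vec + f.vec := by
      calc (D.σ 0 • f).vec + (D.σ 0 • f).vec = (Q.mulVec a + b) + (a + P.mulVec b) :=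
            congrArg₂ (· + ·) h1 h0
        _ = (a + b) + (Q.mulVec a + P.mulVec b) := by abel
        _ = f.vec + f.vec := congrArg₂ (· + ·) hab.symm h2.symm
    funext i
    have := congrFun h4 i
    simp only [Pi.add_apply] at this
    linarith
  refine ⟨?_, ?_⟩
  · rw [← D.fixed_σ]; exact h3
  · rw [← D.fixed_σ]; exact e01.trans h3

variable {D}

/-- The point of `γ 0` closest to a point of `γ 1`. -/
theorem exists_center {R₀ : ℝ} (h : setDist (D.γ 0) (D.γ 1) = R₀) :
    ∃ m ∈ D.γ 0, m ∈ nearestProj (D.γ 0) (D.γ 1) ∧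
      coshDist m ((D.σ 0 * D.σ 1) • m) ≤ 2 * Real.cosh (R₀ + 1) ^ 2 := by
  obtain ⟨z, hz, w, hw, hzw⟩ := exists_coshDist_lt (D.isHypSubspace_γ 0).1
    -- Any bound above the infimum would do; this avoids showing that it is attained.
    (D.isHypSubspace_γ 1).1 (R := R₀ + 1) (by rw [h]; linarith)
  obtain ⟨m, hm⟩ := (D.isHypSubspace_γ 0).exists_foot w
  refine ⟨m, hm.1, hm.mem_nearestProj hw, ?_⟩
  have h1 : coshDist w m ≤ Real.cosh (R₀ + 1) := by
    have h2 := hm.2 z hz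
    have h3 := le_mul_of_one_le_right (coshDist_pos w m).le (one_le_coshDist m z)
    rw [coshDist_comm] at hzw
    linarith
  -- As `σ 0` fixes `m` and `σ 1` fixes `w`, the displacement of `m` is at most twice its distance
  -- from `w`.
  rw [D.σ_comm, mul_smul, D.σ_smul_γ hm.1]
  have h2 := coshDist_triangle m w (D.σ 1 • m)
  have h3 : coshDist w (D.σ 1 • m) = coshDist w m := by
    conv_lhs => rw [← D.σ_smul_γ hw]
    rw [coshDist_smul]
  rw [h3, coshDist_comm m w] at h2
  nlinarith [coshDist_pos w m]

/-- The center of a square is far away from the geodesics of the orbit that do not belong to the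
square. -/
theorem le_coshDist_center {R₀ R R₁ A : ℝ} (hD : D.Separated R₀ R R₁) (hR : 0 ≤ R)
    (hR₁ : 0 ≤ R₁) (hA : A ≤ Real.cosh R) (hA₁ : A ≤ Real.cosh R₁) {m : Hyp 5}
    (hm : m ∈ D.γ 0) (hm' : m ∈ nearestProj (D.γ 0) (D.γ 1)) {g h : D.G} {j : Fin 2}
    (hj : (h : IsomHyp 5) • D.γ j ∉ doors (none, g)) {z : Hyp 5}
    (hz : z ∈ (h : IsomHyp 5) • D.γ j) : A ≤ coshDist ((g : IsomHyp 5) • m) z := by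
  have hne : ∀ i, (g : IsomHyp 5) • D.γ i ≠ (h : IsomHyp 5) • D.γ j := fun i e =>
    hj ⟨i, .inl rfl, e.symm⟩
  by_cases hd : R ≤ setDist ((g : IsomHyp 5) • D.γ 0) ((h : IsomHyp 5) • D.γ j)
  · exact hA.trans (cosh_le_coshDist hR hd (Set.smul_mem_smul_set hm) hz)
  obtain ⟨k, a, b, hab, ha, hb⟩ := hD.exists_smul_eq (hne 0) hd
  obtain ⟨rfl, -⟩ := smul_γ_eq ha
  obtain rfl : b = 1 := by omega
  obtain ⟨f, hf⟩ := (D.isHypSubspace_γ 0).exists_foot ((g : IsomHyp 5)⁻¹ • z)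
  have hz' : (g : IsomHyp 5)⁻¹ • z ∈ ((g : IsomHyp 5)⁻¹ * h) • D.γ j := by
    rw [mul_smul]; exact Set.smul_mem_smul_set hz
  -- Both this geodesic, moved back by `g`, and `γ 1` are now at distance `R₀` from `γ 0`, so their
  -- projections are `R₁` apart, and `m` lies in the second one.
  have key := hD.dist_proj 0 (((g : IsomHyp 5)⁻¹ * h) • D.γ j)
    ⟨_, mul_mem (inv_mem g.2) h.2, j, rfl⟩ (D.γ 1) ⟨1, one_mem _, 1, (one_smul _ _).symm⟩
    (by
      intro e
      apply hne 1
      rw [← e, smul_smul, mul_inv_cancel_left])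
    (by
      rw [← setDist_smul (g : IsomHyp 5), smul_smul, mul_inv_cancel_left, ha, hb, setDist_smul,
        setDist_comm, hD.dist_eq])
    (by rw [setDist_comm, hD.dist_eq])
  have h1 := cosh_le_coshDist hR₁ key (hf.mem_nearestProj hz') hm'
  have h2 := hf.2 m hm
  have h3 : coshDist ((g : IsomHyp 5) • m) z = coshDist ((g : IsomHyp 5)⁻¹ • z) m := by
    rw [← coshDist_smul (g : IsomHyp 5)⁻¹, inv_smul_smul, coshDist_comm]
  rw [h3, h2]
  exact (hA₁.trans h1).trans
    (le_mul_of_one_le_left (coshDist_pos _ _).le (one_le_coshDist _ _))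

/-- The possible end points of a segment that arrives at the letter `C` from `η`. -/
def Enter (m : Hyp 5) (C : D.Letter) (η ξ : Hyp 5) : Prop :=
  match C.1 with
  | none => ξ = (C.2 : IsomHyp 5) • m
  | some i => ξ ∈ (C.2 : IsomHyp 5) • D.γ i ∧
      ∃ f, IsFoot ((C.2 : IsomHyp 5) • D.γ i) η f ∧ coshDist ξ f ^ 2 ≤ 2

/-- The initial point of a segment that leads from the letter `C` to `ξ`. -/
def Leave (m : Hyp 5) (C : D.Letter) (η ξ : Hyp 5) : Prop :=
  match C.1 with
  | none => η = (C.2 : IsomHyp 5) • m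
  | some i => IsFoot ((C.2 : IsomHyp 5) • D.γ i) ξ η

theorem exists_enter (m : Hyp 5) (C : D.Letter) (p : Hyp 5) : ∃ ξ, Enter m C p ξ := by
  obtain ⟨_ | i, g⟩ := C
  · exact ⟨_, rfl⟩
  · obtain ⟨f, hf⟩ := ((D.isHypSubspace_γ i).smul (g : IsomHyp 5)).exists_foot p
    exact ⟨f, hf.1, f, hf, by rw [coshDist_self]; norm_num⟩

theorem exists_leave (m : Hyp 5) (C : D.Letter) (q : Hyp 5) : ∃ η, Leave m C η q := by
  obtain ⟨_ | i, g⟩ := C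
  · exact ⟨_, rfl⟩
  · exact ((D.isHypSubspace_γ i).smul (g : IsomHyp 5)).exists_foot q

/-- The segment joins two centres, or a centre to its foot, or runs along an approximate common
perpendicular of two geodesics. -/
theorem exists_segment {R₀ R R₁ A : ℝ} (hD : D.Separated R₀ R R₁) (hR : 0 ≤ R)
    (hR₁ : 0 ≤ R₁) (hA : A ≤ Real.cosh R) (hA₁ : A ≤ Real.cosh R₁) {m : Hyp 5}
    (hm : m ∈ D.γ 0) (hm' : m ∈ nearestProj (D.γ 0) (D.γ 1)) {C C' : D.Letter}
    (hC : Compat R C C') :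
    ∃ η ∈ D.L, ∃ ξ ∈ D.L, Leave m C η ξ ∧ Enter m C' η ξ ∧ A ≤ coshDist η ξ := by
  have hmL : ∀ g : D.G, (g : IsomHyp 5) • m ∈ D.L := fun g =>
    D.smul_mem_L g (D.γ_subset_L 0 hm)
  have hfoot : ∀ (i : Fin 2) (g : D.G) (q : Hyp 5),
      ∃ f, IsFoot ((g : IsomHyp 5) • D.γ i) q f := fun i g =>
    ((D.isHypSubspace_γ i).smul (g : IsomHyp 5)).exists_foot
  have hfar := @le_coshDist_center D R₀ R R₁ A hD hR hR₁ hA hA₁ m hm hm'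
  obtain ⟨_ | i, g⟩ := C <;> obtain ⟨_ | j, h⟩ := C'
  · refine ⟨_, hmL g, _, hmL h, rfl, rfl, hfar (j := 0) (h := h) ?_ (Set.smul_mem_smul_set hm)⟩
    exact Set.disjoint_right.1 hC.1 ⟨0, .inl rfl, rfl⟩
  · obtain ⟨f, hf⟩ := hfoot j h ((g : IsomHyp 5) • m)
    refine ⟨_, hmL g, f, D.smul_γ_subset_L _ _ hf.1, rfl,
      ⟨hf.1, f, hf, by rw [coshDist_self]; norm_num⟩, hfar (j := j) (h := h) ?_ hf.1⟩
    exact Set.disjoint_right.1 hC.1 ⟨j, .inr rfl, rfl⟩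
  · obtain ⟨f, hf⟩ := hfoot i g ((h : IsomHyp 5) • m)
    refine ⟨f, D.smul_γ_subset_L _ _ hf.1, _, hmL h, hf, rfl, ?_⟩
    rw [coshDist_comm]
    refine hfar (j := i) (h := g) ?_ hf.1
    exact Set.disjoint_left.1 hC.1 ⟨i, .inr rfl, rfl⟩
  -- Projecting back and forth replaces the common perpendicular: `p'` is exactly the foot of `q`,
  -- while `q` is the foot of `p'` only up to a bounded error. This is the slack allowed in `Enter`.
  · obtain ⟨p, hp⟩ := ((D.isHypSubspace_γ i).smul (g : IsomHyp 5)).1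
    obtain ⟨q, hq⟩ := hfoot j h p
    obtain ⟨p', hp'⟩ := hfoot i g q
    obtain ⟨q', hq'⟩ := hfoot j h p'
    exact ⟨p', D.smul_γ_subset_L _ _ hp'.1, q, D.smul_γ_subset_L _ _ hq.1, hp',
      ⟨hq.1, q', hq', hq.coshDist_sq_le hp hp' hq'⟩,
      hA.trans (cosh_le_coshDist hR (hC.2 i j rfl rfl) hp'.1 hq.1)⟩

/-- Crossing a geodesic. -/
theorem coshDist_le_of_some {α : ℝ} (hα : 0 < α) {i : Fin 2}
    (hang : MeetAtAngle (D.γ i) D.L (D.σ i • D.L) α) {η ξ f η' ξ' : Hyp 5} (hη : η ∈ D.L)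
    (hξ' : ξ' ∈ D.L) (hξ : ξ ∈ D.γ i) (hf : IsFoot (D.γ i) η f) (hξf : coshDist ξ f ^ 2 ≤ 2)
    (hη' : IsFoot (D.γ i) ξ' η') :
    coshDist η ξ * coshDist ξ (D.σ i • η') * coshDist η' ξ' ≤
      4 / (1 - Real.cos (min α (Real.pi / 2))) * coshDist η (D.σ i • ξ') := by
  have hγ : D.σ i • D.γ i = D.γ i := by
    ext x
    constructor
    · rintro ⟨y, hy, rfl⟩
      show D.σ i • y ∈ _
      rwa [D.σ_smul_γ hy]
    · exact fun hx => ⟨x, hx, D.σ_smul_γ hx⟩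
  have hη'' : IsFoot (D.γ i) (D.σ i • ξ') η' := by
    have := hη'.smul (D.σ i)
    rwa [hγ, D.σ_smul_γ hη'.1] at this
  have key := coshDist_le_of_meetAtAngle hα hang (D.γ_subset_L i)
    (by rw [← hγ]; exact Set.smul_set_mono (D.γ_subset_L i)) hη (Set.smul_mem_smul_set hξ') hf hη''
  have hk : 0 < 1 - Real.cos (min α (Real.pi / 2)) := by
    have h0 : 0 < min α (Real.pi / 2) := lt_min hα (by positivity)
    have h1 := Real.cos_lt_cos_of_nonneg_of_le_pi_div_two le_rfl
      (min_le_right α (Real.pi / 2)) h0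
    rw [Real.cos_zero] at h1
    linarith
  have e : coshDist η' (D.σ i • ξ') = coshDist η' ξ' := by
    conv_lhs => rw [← D.σ_smul_γ hη'.1]
    rw [coshDist_smul]
  rw [e] at key
  rw [D.σ_smul_γ hη'.1, hf.2 ξ hξ, div_mul_eq_mul_div, le_div_iff₀ hk, coshDist_comm f ξ]
  have h1 := coshDist_triangle ξ f η'
  have a0 := coshDist_pos η f
  have b0 := coshDist_pos ξ f
  have c0 := coshDist_pos f η'
  have d0 := coshDist_pos η' ξ'
  -- In the constant 4, one factor 2 comes from the triangle inequality through `f`, the other from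
  -- the distance between `ξ` and `f`.
  calc coshDist η f * coshDist ξ f * coshDist ξ η' * coshDist η' ξ' *
        (1 - Real.cos (min α (Real.pi / 2)))
      ≤ coshDist η f * coshDist ξ f * (2 * coshDist ξ f * coshDist f η') * coshDist η' ξ' *
        (1 - Real.cos (min α (Real.pi / 2))) := by gcongr
    _ = 2 * coshDist ξ f ^ 2 * ((1 - Real.cos (min α (Real.pi / 2))) *
        (coshDist η f * coshDist f η' * coshDist η' ξ')) := by ring
    _ ≤ 2 * 2 * ((1 - Real.cos (min α (Real.pi / 2))) *
        (coshDist η f * coshDist f η' * coshDist η' ξ')) := by gcongr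
    _ ≤ 2 * 2 * coshDist η (D.σ i • ξ') := by gcongr
    _ = 4 * coshDist η (D.σ i • ξ') := by ring

/-- The local estimate at a letter. -/
theorem coshDist_le_of_letter {r α T K : ℝ} (hr : 0 < r) (hα : 0 < α)
    (hdist : r / 2 ≤ setDist (D.S 0 ∩ D.S 1) D.L)
    (hang : ∀ i, MeetAtAngle (D.γ i) D.L (D.σ i • D.L) α) {m : Hyp 5} (hm : m ∈ D.γ 0)
    (hT : coshDist m ((D.σ 0 * D.σ 1) • m) ≤ T)
    (hK₁ : 4 / (1 - Real.cos (min α (Real.pi / 2))) ≤ K)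
    (hK₂ : 16 * T ^ 2 / (2 * Real.sinh (r / 2) ^ 2 / T) ^ 4 ≤ K) (C : D.Letter)
    {η ξ η' ξ' : Hyp 5} (hη : η ∈ D.L) (hξ' : ξ' ∈ D.L) (hen : Enter m C η ξ)
    (hex : Leave m C η' ξ') :
    coshDist η ξ * coshDist ξ (letter D.G.subtype D.σ C • η') * coshDist η' ξ' ≤
      K * coshDist η (letter D.G.subtype D.σ C • ξ') := by
  obtain ⟨o, g⟩ := C
  obtain ⟨η, rfl⟩ : ∃ x, η = (g : IsomHyp 5) • x := ⟨_, (smul_inv_smul (g : IsomHyp 5) η).symm⟩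
  obtain ⟨ξ, rfl⟩ : ∃ x, ξ = (g : IsomHyp 5) • x := ⟨_, (smul_inv_smul (g : IsomHyp 5) ξ).symm⟩
  obtain ⟨η', rfl⟩ : ∃ x, η' = (g : IsomHyp 5) • x :=
    ⟨_, (smul_inv_smul (g : IsomHyp 5) η').symm⟩
  obtain ⟨ξ', rfl⟩ : ∃ x, ξ' = (g : IsomHyp 5) • x :=
    ⟨_, (smul_inv_smul (g : IsomHyp 5) ξ').symm⟩
  have hη0 : η ∈ D.L := by simpa using D.inv_smul_mem_L g hη
  have hξ0 : ξ' ∈ D.L := by simpa using D.inv_smul_mem_L g hξ'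
  match o, hen, hex with
  | none, hen, hex =>
    have hl : ∀ x : Hyp 5, letter D.G.subtype D.σ (none, g) • (g : IsomHyp 5) • x =
        (g : IsomHyp 5) • (D.σ 0 * D.σ 1) • x := fun x => by
      show ((g : IsomHyp 5) * (D.σ 0 * D.σ 1) * (g : IsomHyp 5)⁻¹) • (g : IsomHyp 5) • x = _
      rw [mul_smul, mul_smul, inv_smul_smul]
    rw [hl, hl]
    simp only [coshDist_smul]
    obtain rfl : ξ = m := smul_left_cancel _ hen
    obtain rfl : η' = ξ := smul_left_cancel _ hex
    have key := coshDist_le_of_involution D.isHypSubspace_L D.mul_σ_mul_self hr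
      (fun f hf x hx => cosh_le_coshDist (by linarith) hdist (D.mem_S_inter_S_of_fixed hf) hx)
      (D.γ_subset_L 0 hm) hT hη0 hξ0
    exact key.trans (mul_le_mul_of_nonneg_right hK₂ (coshDist_pos _ _).le)
  | some i, hen, hex =>
    have hl : ∀ x : Hyp 5, letter D.G.subtype D.σ (some i, g) • (g : IsomHyp 5) • x =
        (g : IsomHyp 5) • D.σ i • x := fun x => by
      show ((g : IsomHyp 5) * D.σ i * (g : IsomHyp 5)⁻¹) • (g : IsomHyp 5) • x = _
      rw [mul_smul, mul_smul, inv_smul_smul]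
    rw [hl, hl]
    simp only [coshDist_smul]
    obtain ⟨hξ, f, hf, hξf⟩ := hen
    obtain ⟨f, rfl⟩ : ∃ x, f = (g : IsomHyp 5) • x :=
      ⟨_, (smul_inv_smul (g : IsomHyp 5) f).symm⟩
    rw [coshDist_smul] at hξf
    have hf' := hf.smul (g : IsomHyp 5)⁻¹
    have hex' := IsFoot.smul hex (g : IsomHyp 5)⁻¹
    simp only [inv_smul_smul] at hf' hex'
    have key := coshDist_le_of_some hα (hang i) hη0 hξ0
      (Set.smul_mem_smul_set_iff.1 hξ) hf' hξf hex'
    exact key.trans (mul_le_mul_of_nonneg_right hK₁ (coshDist_pos _ _).le)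

theorem rep_vertexHom_zero (g : D.G) : D.rep (D.vertexHom 0 g) = g := by
  refine (D.quadrilateral.lift_of D.vertexRep D.vertexRep_compatible 0 g).trans ?_
  show (1 : IsomHyp 5) * g * 1⁻¹ = g
  group

theorem continuous_coshDist_smul (p : Hyp 5) :
    Continuous fun h : IsomHyp 5 => coshDist p (h • p) := by
  have h1 : Continuous fun h : IsomHyp 5 => h.1.1.mulVec p.vec :=
    (Units.continuous_val.comp continuous_subtype_val).matrix_mulVec continuous_const
  have h2 : ∀ i, Continuous fun h : IsomHyp 5 => h.1.1.mulVec p.vec i := fun i =>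
    (continuous_apply i).comp h1
  show Continuous fun h : IsomHyp 5 => -lorentz p.vec (h.1.1.mulVec p.vec)
  unfold lorentz
  fun_prop

/-- A representation that moves a point of `L` far away, except for the elements of the first
vertex group, is faithful and has discrete image. -/
theorem injective_and_discrete {p : Hyp 5}
    (h : ∀ x, (∃ g, x = D.vertexHom 0 g) ∨ 2 ≤ coshDist p (D.rep x • p)) :
    Function.Injective D.rep ∧ DiscreteTopology D.rep.range := by
  constructor
  · rw [injective_iff_map_eq_one]
    intro x hx
    rcases h x with ⟨g, rfl⟩ | h
    · rw [rep_vertexHom_zero] at hx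
      rw [show g = 1 from Subtype.ext hx, map_one]
    · rw [hx, one_smul, coshDist_self] at h
      norm_num at h
  · have := D.discrete
    obtain ⟨U, hU, hU1⟩ := isOpen_induced_iff.1 (isOpen_discrete ({1} : Set D.G))
    apply discreteTopology_of_isOpen_singleton_one
    -- Small displacement of `p` forces an element of the image into `G`, where `U` isolates the
    -- identity.
    refine isOpen_induced_iff.2 ⟨U ∩ {h | coshDist p (h • p) < 2},
      hU.inter (isOpen_lt (continuous_coshDist_smul p) continuous_const), ?_⟩
    ext ⟨y, x, rfl⟩
    constructor
    · rintro ⟨h1, h2⟩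
      rcases h x with ⟨g, rfl⟩ | h
      · rw [Set.mem_singleton_iff]
        apply Subtype.ext
        show D.rep (D.vertexHom 0 g) = 1
        have h1' : g ∈ Subtype.val ⁻¹' U := by
          show (g : IsomHyp 5) ∈ U
          rw [← rep_vertexHom_zero g]
          exact h1
        rw [hU1] at h1'
        rw [rep_vertexHom_zero, Set.mem_singleton_iff.1 h1']
        rfl
      · exact absurd h2 (not_lt.2 h)
    · intro h1
      have h1' : D.rep x = 1 := congrArg Subtype.val (Set.mem_singleton_iff.1 h1)
      have h2 : (1 : D.G) ∈ Subtype.val ⁻¹' U := by rw [hU1]; rfl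
      show D.rep x ∈ U ∧ coshDist p (D.rep x • p) < 2
      rw [h1', one_smul, coshDist_self]
      exact ⟨h2, one_lt_two⟩

end QuadrilateralData

theorem theorem6p2 (R₀ r α : ℝ) (hR₀ : 0 < R₀) (hr : 0 < r) (hα : 0 < α) :
    ∃ C : ℝ, ∀ (R R₁ : ℝ), C ≤ R → C ≤ R₁ →
      ∀ D : QuadrilateralData, D.Separated R₀ R R₁ →
        r / 2 ≤ setDist (D.S 0 ∩ D.S 1) D.L →
        (∀ i, MeetAtAngle (D.γ i) D.L (D.σ i • D.L) α) →
        Function.Injective D.rep ∧ DiscreteTopology D.rep.range := by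
  -- `T` bounds the displacement of the centre; `K` dominates the constants of single and double
  -- crossings.
  set T := 2 * Real.cosh (R₀ + 1) ^ 2
  set K := max 1 (max (4 / (1 - Real.cos (min α (Real.pi / 2))))
    (16 * T ^ 2 / (2 * Real.sinh (r / 2) ^ 2 / T) ^ 4))
  have hK : 1 ≤ K := le_max_left _ _
  have hcosh : ∀ x : ℝ, 32 * K ^ 2 ≤ x → 0 ≤ x ∧ 32 * K ^ 2 ≤ Real.cosh x := fun x hx => by
    have hx0 : 0 ≤ x := le_trans (by positivity) hx
    exact ⟨hx0, (hx.trans (Real.self_le_sinh_iff.2 hx0)).trans (Real.sinh_lt_cosh x).le⟩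
  -- By `x ≤ sinh x ≤ cosh x`, the same number bounds the distances and their hyperbolic cosines
  -- from below.
  refine ⟨32 * K ^ 2, fun R R₁ hR hR₁ D hD hdist hang => ?_⟩
  obtain ⟨hR0, hRA⟩ := hcosh R hR
  obtain ⟨hR₁0, hR₁A⟩ := hcosh R₁ hR₁
  obtain ⟨m, hm, hm', hT⟩ := QuadrilateralData.exists_center hD.dist_eq
  obtain ⟨p, hp⟩ := D.isHypSubspace_L.1
  apply QuadrilateralData.injective_and_discrete (p := p)
  intro x
  refine (D.exists_reduced_word hD x).imp id ?_
  rintro ⟨l, hl, hlen, g, e⟩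
  rw [e, mul_smul]
  exact two_le_coshDist_of_chain hK le_rfl
    (fun C η hη ξ η' ξ' hξ' hen hex => QuadrilateralData.coshDist_le_of_letter hr hα hdist hang
      hm hT ((le_max_left _ _).trans (le_max_right _ _))
      ((le_max_right _ _).trans (le_max_right _ _)) C hη hξ' hen hex)
    (fun C p _ => QuadrilateralData.exists_enter m C p)
    (fun C q _ => QuadrilateralData.exists_leave m C q)
    (fun C C' hC => QuadrilateralData.exists_segment hD hR0 hR₁0 hRA hR₁A hm hm' hC)
    hp (D.smul_mem_L g hp) hl hlen
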